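/- Let $\mathcal X\subseteq\mathbb R^d$ be Lebesgue measurable, equipped with the $\sigma$-algebra of its Lebesgue-measurable subsets and with Lebesgue measure, and let $\|\cdot\|$ be a norm on $\mathbb R^d$. Let $\pi:\mathcal X\to[0,\infty)$ be a probability density (also denoting the corresponding distribution), let $\hat\pi:\mathcal X\to[0,\infty)$ be a measurable function with $\hat\pi(x)>0$ for $\pi$-almost all $x$, and let $q:\mathcal X\times\mathcal X\to[0,\infty)$ be a jointly measurable proposal density, $\int_{\mathcal X}q(x,y)\,dy=1$ for all $x\in\mathcal X$. Put $$r_{MH}(x,y)=\frac{\pi(y)q(y,x)}{\pi(x)q(x,y)},\qquad r_1(x,y)=\frac{\hat\pi(y)q(y,x)}{\hat\pi(x)q(x,y)},\qquad r_2(x,y)=\frac{\pi(y)/\hat\pi(y)}{\pi(x)/\hat\pi(x)},$$ with values in $[0,\infty]$ (where $a/0=\infty$ for $a>0$ and $0/0=0$), $\alpha_{MH}=1\wedge r_{MH}$ and $\alpha_{DA}=(1\wedge r_1)(1\wedge r_2)$. The Metropolis--Hastings (MH) kernel $P_{MH}$ and the delayed-acceptance (DA) kernel $P_{DA}$ are $$P(x,dy)=q(x,y)\,\alpha(x,y)\,dy+\Bigl[1-\int_{\mathcal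 X} q(x,z)\,\alpha(x,z)\,dz\Bigr]\delta_x(dy)$$ with $\alpha=\alpha_{MH}$ and $\alpha=\alpha_{DA}$ respectively. A kernel $P$ with stationary distribution $\pi$ is *variance bounding* if for every $f\in L^2(\pi)$ the asymptotic variance $\lim_{n\to\infty}n\,\mathrm{Var}\bigl[\frac1n\sum_{i=1}^nf(X_i)\bigr]$ exists and is finite, where $(X_i)_{i\ge1}$ is the Markov chain with kernel $P$ and $X_1\sim\pi$. Suppose that $q$ is *local*: for each $\epsilon>0$ there is an $r<\infty$ such that $\int_{\{y\in\mathcal X:\|y-x\|\ge r\}}q(x,y)\,dy<\epsilon$ for all $x\in\mathcal X$. Suppose also that there is a function $h:[0,\infty)\to[0,\infty)$, bounded on $[0,r]$ for every $r<\infty$, such that for $\pi$-almost all $x$ every $y\in\mathcal X$ with $q(x,y)>0$ and $|\log r_2(x,y)|>h(\|y-x\|)$ lies in $$\mathcal C(x)=\{y\in\mathcal X:\ \mathrm{sign}[\log r_1(x,y)]\ \mathrm{sign}[\log r_2(x,y)]\ge0\}$$ (with $\log0=-\infty$ and $\log\infty=\infty$). If $P_{MH}$ is variance bounding, then so is $P_{DA}$.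 -/

import Mathlib

open MeasureTheory ProbabilityTheory Filter Topology
open scoped NNReal ENNReal

namespace DelayedAcceptance

/-! ### The state space -/

/-- The points of `X ⊆ ℝ^d`, as a type of its own. It carries the σ-algebra of all
Lebesgue-measurable sets in `X` (and not the Borel σ-algebra). -/
def StateSpace {d : ℕ} (X : Set (EuclideanSpace ℝ (Fin d))) : Type :=
  {x : EuclideanSpace ℝ (Fin d) // x ∈ X}

namespace StateSpace

variable {d : ℕ} {X : Set (EuclideanSpace ℝ (Fin d))}

/-- The point of `ℝ^d` underlying a state. -/
def pt (x : StateSpace X) : EuclideanSpace ℝ (Fin d) := x.1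

/-- The inclusion of `X` in `ℝ^d`, where `ℝ^d` is equipped with its Lebesgue σ-algebra. -/
noncomputable def incl (x : StateSpace X) :
    NullMeasurableSpace (EuclideanSpace ℝ (Fin d)) volume := x.1

/-- The σ-algebra of Lebesgue-measurable subsets of `X`. -/
noncomputable instance instMeasurableSpace : MeasurableSpace (StateSpace X) :=
  MeasurableSpace.comap incl inferInstance

end StateSpace

/-- Lebesgue measure on the Lebesgue-measurable subsets of `X` (for Lebesgue-measurable `X`). -/
noncomputable def lebesgue {d : ℕ} (X : Set (EuclideanSpace ℝ (Fin d))) :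
    Measure (StateSpace X) :=
  Measure.comap StateSpace.incl
    (volume : Measure (EuclideanSpace ℝ (Fin d))).completion

instance instSigmaFiniteLebesgue {d : ℕ} (X : Set (EuclideanSpace ℝ (Fin d))) :
    SigmaFinite (lebesgue X) := by
  let S : ℕ → Set (EuclideanSpace ℝ (Fin d)) := spanningSets volume
  have hS : ∀ n, MeasurableSet (StateSpace.incl (X := X) ⁻¹' (S n)) := fun n =>
    ⟨S n, (measurableSet_spanningSets volume n).nullMeasurableSet, rfl⟩
  refine ⟨⟨⟨fun n => StateSpace.incl ⁻¹' (S n), fun _ => trivial, fun n => ?_, ?_⟩⟩⟩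
  · refine (Measure.comap_apply_le _ _ (hS n).nullMeasurableSet).trans_lt ?_
    refine (measure_mono (Set.image_preimage_subset _ _)).trans_lt ?_
    rw [Measure.completion_apply]
    exact measure_spanningSets_lt_top volume n
  · refine Set.eq_univ_of_forall fun x => Set.mem_iUnion.2 ?_
    have h : x.pt ∈ ⋃ n, S n := by
      rw [iUnion_spanningSets]
      trivial
    obtain ⟨n, hn⟩ := Set.mem_iUnion.1 h
    exact ⟨n, hn⟩

/-! ### Stationary Markov chains, asymptotic variance, variance bounding -/

section Chain

variable {α : Type*} [MeasurableSpace α]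

/-- `chainLaw P μ n` is the joint law of the first `n + 1` states of the Markov chain with
transition kernel `P` and initial law `μ`: given the states so far, the next state is
drawn from `P` at the last of them. -/
noncomputable def chainLaw (P : Kernel α α) (μ : Measure α) : (n : ℕ) → Measure (Fin (n + 1) → α)
  | 0 => μ.map (fun x _ => x)
  | n + 1 =>
      ((chainLaw P μ n) ⊗ₘ
        (P.comap (fun ω : Fin (n + 1) → α => ω (Fin.last n)) (measurable_pi_apply _))).map
        (fun p => (Fin.snoc p.1 p.2 : Fin (n + 2) → α))

/-- `n · Var[(1/n) ∑_{i=1}^n f(X_i)]` for the chain with kernel `P` started from `μ`, where the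
number of terms is `n = k + 1`. -/
noncomputable def scaledVariance (f : α → ℝ) (P : Kernel α α) (μ : Measure α) (k : ℕ) : ℝ :=
  ((k : ℝ) + 1) *
    variance (fun ω : Fin (k + 1) → α => (1 / ((k : ℝ) + 1)) * ∑ i, f (ω i)) (chainLaw P μ k)

/-- The asymptotic variance of `f` exists and is finite. -/
def HasFiniteAsymptoticVariance (f : α → ℝ) (P : Kernel α α) (μ : Measure α) : Prop :=
  ∃ v : ℝ, Tendsto (scaledVariance f P μ) atTop (𝓝 v)

/-- `P` is variance bounding: every `f ∈ L²(π)` has a finite asymptotic variance. -/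
def VarianceBounding (P : Kernel α α) (π : Measure α) : Prop :=
  ∀ f : α → ℝ, MemLp f 2 π → HasFiniteAsymptoticVariance f P π

/-! ### Propose-accept-reject kernels

Ratios are taken in `[0, ∞]`, with `a / 0 = ∞` for `a > 0` and `0 / 0 = 0`. -/

/-- The propose-accept-reject kernel
`P(x, dy) = q(x, y) a(x, y) dy + [1 - ∫ q(x, z) a(x, z) dz] δ_x(dy)` with proposal density `q`
(with respect to `vol`) and acceptance probability `a`. -/
noncomputable def parKernel (vol : Measure α) [SFinite vol] (q : α → α → ℝ≥0)
    (a : α → α → ℝ≥0∞) : Kernel α α :=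
  (Kernel.const α vol).withDensity (fun x y => (q x y : ℝ≥0∞) * a x y) +
    Kernel.id.withDensity (fun x _ => 1 - ∫⁻ z, (q x z : ℝ≥0∞) * a x z ∂vol)

/-- `r_MH(x, y) = π(y) q(y, x) / (π(x) q(x, y))`. -/
noncomputable def rMH (p : α → ℝ≥0) (q : α → α → ℝ≥0) (x y : α) : ℝ≥0∞ :=
  ((p y : ℝ≥0∞) * q y x) / ((p x : ℝ≥0∞) * q x y)

/-- `r_1(x, y) = π̂(y) q(y, x) / (π̂(x) q(x, y))`, the ratio of the screening stage. -/
noncomputable def rDA₁ (phat : α → ℝ≥0) (q : α → α → ℝ≥0) (x y : α) : ℝ≥0∞ :=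
  ((phat y : ℝ≥0∞) * q y x) / ((phat x : ℝ≥0∞) * q x y)

/-- `r_2(x, y) = (π(y) / π̂(y)) / (π(x) / π̂(x))`, the ratio of the correction stage. -/
noncomputable def rDA₂ (p phat : α → ℝ≥0) (x y : α) : ℝ≥0∞ :=
  ((p y : ℝ≥0∞) / phat y) / ((p x : ℝ≥0∞) / phat x)

/-- The Metropolis-Hastings kernel. -/
noncomputable def mhKernel (vol : Measure α) [SFinite vol] (p : α → ℝ≥0) (q : α → α → ℝ≥0) :
    Kernel α α :=
  parKernel vol q (fun x y => min 1 (rMH p q x y))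

/-- The delayed-acceptance kernel. -/
noncomputable def daKernel (vol : Measure α) [SFinite vol] (p phat : α → ℝ≥0)
    (q : α → α → ℝ≥0) : Kernel α α :=
  parKernel vol q (fun x y => min 1 (rDA₁ phat q x y) * min 1 (rDA₂ p phat x y))

/-- The log-error discrepancy `|log r_2(x, y)| ∈ [0, ∞]`. -/
noncomputable def logErrorDiscrepancy (p phat : α → ℝ≥0) (x y : α) : ℝ≥0∞ :=
  (ENNReal.log (rDA₂ p phat x y)).abs

/-- The 'no problem' set `C(x)`: the `y` for which `log r_1(x, y)` and `log r_2(x, y)` do not have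
strictly opposite signs. -/
noncomputable def noProblemSet (p phat : α → ℝ≥0) (q : α → α → ℝ≥0) (x : α) : Set α :=
  {y | 0 ≤ SignType.sign (ENNReal.log (rDA₁ phat q x y)) *
    SignType.sign (ENNReal.log (rDA₂ p phat x y))}

end Chain

/-- The distance `‖y - x‖` between two states, in the norm `N` on `ℝ^d`. -/
noncomputable def stateDist {d : ℕ} {X : Set (EuclideanSpace ℝ (Fin d))}
    (N : Seminorm ℝ (EuclideanSpace ℝ (Fin d))) (x y : StateSpace X) : ℝ≥0 :=
  ⟨N (y.pt - x.pt), apply_nonneg N _⟩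

/-- The proposal density `q` is local: for each `ε > 0` there is an `r` such that for all `x ∈ X`
the proposal from `x` falls outside the open ball `B(x, r)` with probability less than `ε`. -/
def IsLocal {d : ℕ} {X : Set (EuclideanSpace ℝ (Fin d))}
    (N : Seminorm ℝ (EuclideanSpace ℝ (Fin d))) (q : StateSpace X → StateSpace X → ℝ≥0) : Prop :=
  ∀ ε : ℝ≥0∞, 0 < ε → ∃ r : ℝ≥0, ∀ x : StateSpace X,
    ∫⁻ y in {y | stateDist N x y < r}ᶜ, (q x y : ℝ≥0∞) ∂(lebesgue X) < ε

end DelayedAcceptance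

/-! Both kernels are reversible. For a reversible chain, variance bounding is equivalent to a
spectral gap of the transition operator at `1` on mean-zero `L²(π)`, that is, to a Poincaré
inequality `c ∫ f² dπ ≤ ∫∫ (f(x) - f(y))² π(dx) P(x, dy)` for mean-zero `f`
(`varianceBounding_iff_poincare`). Bounded normalized variances give the gap by the uniform
boundedness principle (`exists_gap_of_bounded`); conversely a gap makes `1 - T` surjective and the
variance sums telescope (`exists_tendsto_of_gap`).

Rejections do not enter the right-hand side, so only the rates `flow` of accepted moves matter.
Locality gives a distance `r` beyond which proposals are so rare that they contribute at most half
of the MH inequality. Within distance `r`, let `M` bound `h`. Since `r_MH = r_1 r_2`, delayed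
acceptance loses nothing when `r_1` and `r_2` lie on the same side of `1`, and otherwise at most a
factor `exp M` (`flow_mh_le_flow_da`). So the MH inequality passes to DA with a smaller constant
(`varianceBounding_parKernel_of_flow_le`). -/

namespace DelayedAcceptance

/-! ### Contractions on a Hilbert space: bounded variances and the spectral gap -/

section Hilbert

variable {H : Type*} [NormedAddCommGroup H] [InnerProductSpace ℝ H]

local notation "⟪" x ", " y "⟫" => inner ℝ x y

/-- `(n + 1) + 2 ∑_{m < n} ∑_{k ≤ m} T^{k+1}`, whose quadratic form is the variance of a sum of
`n + 1` consecutive values of a stationary reversible chain with transition operator `T`. -/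
noncomputable def pathSumOp (T : H →L[ℝ] H) (n : ℕ) : H →L[ℝ] H :=
  ((n : ℝ) + 1) • 1 + (2 : ℝ) • ∑ m ∈ Finset.range n, ∑ k ∈ Finset.range (m + 1), T ^ (k + 1)

theorem inner_pow_symm {T : H →L[ℝ] H} (hT : ∀ x y, ⟪T x, y⟫ = ⟪x, T y⟫) (k : ℕ) (x y : H) :
    ⟪(T ^ k) x, y⟫ = ⟪x, (T ^ k) y⟫ := by
  induction k generalizing x y with
  | zero => simp
  | succ k ih =>
    rw [pow_succ, mul_apply_eq_comp, ih, hT, ← mul_apply_eq_comp,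
      ← pow_succ', pow_succ]

theorem pathSumOp_apply (T : H →L[ℝ] H) (n : ℕ) (x : H) :
    pathSumOp T n x = ((n : ℝ) + 1) • x +
      (2 : ℝ) • ∑ m ∈ Finset.range n, ∑ k ∈ Finset.range (m + 1), (T ^ (k + 1)) x := by
  simp [pathSumOp]

theorem inner_pathSumOp_symm {T : H →L[ℝ] H} (hT : ∀ x y, ⟪T x, y⟫ = ⟪x, T y⟫) (n : ℕ)
    (x y : H) : ⟪pathSumOp T n x, y⟫ = ⟪x, pathSumOp T n y⟫ := by
  simp only [pathSumOp_apply, inner_add_left, inner_add_right, real_inner_smul_left,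
    real_inner_smul_right, sum_inner, inner_sum, inner_pow_symm hT]

/-- A polynomial in `T` is its value at `1` up to a multiple of `1 - T`. -/
theorem exists_norm_pathSumOp_sub_le (T : H →L[ℝ] H) (n : ℕ) :
    ∃ C : ℝ, 0 ≤ C ∧ ∀ x, ‖pathSumOp T n x - (((n : ℝ) + 1) ^ 2) • x‖ ≤ C * ‖x - T x‖ := by
  have hgeom (k : ℕ) : ∃ R : H →L[ℝ] H, T ^ k - 1 = R * (1 - T) :=
    ⟨-∑ i ∈ Finset.range k, T ^ i, by rw [neg_mul, geom_sum_mul_neg]; abel⟩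
  choose R hR using hgeom
  -- At `T = 1` the polynomial has the value `(n + 1) + 2 · n(n + 1)/2 = (n + 1)²`.
  have hkey : pathSumOp T n - (((n : ℝ) + 1) ^ 2) • (1 : H →L[ℝ] H) =
      ((2 : ℝ) • ∑ m ∈ Finset.range n, ∑ k ∈ Finset.range (m + 1), R (k + 1)) * (1 - T) := by
    have h1 : ((2 : ℝ) • ∑ m ∈ Finset.range n, ∑ k ∈ Finset.range (m + 1), R (k + 1)) * (1 - T) =
        (2 : ℝ) • ∑ m ∈ Finset.range n, ∑ k ∈ Finset.range (m + 1), (T ^ (k + 1) - 1) := by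
      simp only [hR, smul_mul_assoc, Finset.sum_mul]
    have h2 (N : ℕ) : ∑ m ∈ Finset.range N, ((m : ℝ) + 1) = N * (N + 1) / 2 := by
      induction N with
      | zero => simp
      | succ N ih => rw [Finset.sum_range_succ, ih]; push_cast; ring
    have h3 : ∑ m ∈ Finset.range n, ∑ k ∈ Finset.range (m + 1), (1 : H →L[ℝ] H) =
        ((n : ℝ) * (n + 1) / 2) • (1 : H →L[ℝ] H) := by
      rw [← h2, Finset.sum_smul]
      refine Finset.sum_congr rfl fun m _ => ?_
      rw [Finset.sum_const, Finset.card_range, ← Nat.cast_smul_eq_nsmul ℝ]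
      push_cast; rfl
    rw [h1]
    simp only [Finset.sum_sub_distrib, h3, pathSumOp]
    module
  refine ⟨‖(2 : ℝ) • ∑ m ∈ Finset.range n, ∑ k ∈ Finset.range (m + 1), R (k + 1)‖,
    norm_nonneg _, fun x => ?_⟩
  have := congrArg (fun S : H →L[ℝ] H => S x) hkey
  simp only [sub_apply, smul_apply,
    one_apply_eq_self, mul_apply_eq_comp] at this
  rw [this]
  exact ContinuousLinearMap.le_opNorm
    ((2 : ℝ) • ∑ m ∈ Finset.range n, ∑ k ∈ Finset.range (m + 1), R (k + 1)) (x - T x)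

/-- Pointwise boundedness of a sequence of symmetric quadratic forms implies uniform boundedness
of the operators. -/
theorem exists_opNorm_le_of_forall_abs_inner_le [CompleteSpace H] {A : ℕ → H →L[ℝ] H}
    (hA : ∀ n x y, ⟪A n x, y⟫ = ⟪x, A n y⟫) (hb : ∀ x, ∃ C, ∀ n, |⟪x, A n x⟫| ≤ C) :
    ∃ C, ∀ n, ‖A n‖ ≤ C := by
  -- Uniform boundedness is used twice: for operators here, and below for the functionals `⟪A n x,
  -- ·⟫` with `x` fixed, which polarization bounds pointwise.
  refine banach_steinhaus fun x => ?_
  have hpol (n : ℕ) (y : H) : ⟪A n x, y⟫ =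
      (⟪x + y, A n (x + y)⟫ - ⟪x - y, A n (x - y)⟫) / 4 := by
    simp only [map_add, map_sub, inner_add_left, inner_add_right, inner_sub_left,
      inner_sub_right]
    rw [← hA n x y, real_inner_comm (A n x) y]
    ring
  have := banach_steinhaus (g := fun n => innerSL ℝ (A n x)) fun y => by
    obtain ⟨C, hC⟩ := hb (x + y)
    obtain ⟨D, hD⟩ := hb (x - y)
    refine ⟨(C + D) / 4, fun n => ?_⟩
    rw [innerSL_apply_apply, hpol, Real.norm_eq_abs, abs_div, abs_of_pos (by norm_num : (0:ℝ) < 4)]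
    gcongr
    exact (abs_sub _ _).trans (add_le_add (hC n) (hD n))
  simpa only [innerSL_apply_norm] using this

/-- Bounded normalized variances force a spectral gap. -/
theorem exists_gap_of_bounded [CompleteSpace H] {T : H →L[ℝ] H}
    (hT : ∀ x y, ⟪T x, y⟫ = ⟪x, T y⟫) (hT1 : ∀ x, ‖T x‖ ≤ ‖x‖)
    (hb : ∀ x, ∃ C, ∀ n : ℕ, |⟪x, pathSumOp T n x⟫ / ((n : ℝ) + 1)| ≤ C) :
    ∃ c : ℝ, 0 < c ∧ ∀ x, c * ‖x‖ ^ 2 ≤ ‖x‖ ^ 2 - ⟪x, T x⟫ := by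
  obtain ⟨K, hK⟩ := exists_opNorm_le_of_forall_abs_inner_le
    (A := fun n : ℕ => (((n : ℝ) + 1)⁻¹) • pathSumOp T n)
    (fun n x y => by
      simp [real_inner_smul_left, real_inner_smul_right, inner_pathSumOp_symm hT])
    (fun x => by
      obtain ⟨C, hC⟩ := hb x
      refine ⟨C, fun n => ?_⟩
      have := hC n
      rwa [div_eq_inv_mul, ← real_inner_smul_right] at this)
  -- One fixed `n ≥ K` suffices: `pathSumOp T n` has norm at most `n(n + 1)`, yet equals `(n + 1)²`
  -- up to a multiple of `1 - T`. The excess `n + 1 ≥ 1` must be paid by `‖x - T x‖`.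
  obtain ⟨n, hn⟩ := exists_nat_ge K
  obtain ⟨C, hC0, hC⟩ := exists_norm_pathSumOp_sub_le T n
  have hn0 : (0 : ℝ) < n + 1 := by positivity
  have h1 (x : H) : ‖x‖ ≤ C * ‖x - T x‖ := by
    have hle : ‖pathSumOp T n x‖ ≤ ((n : ℝ) + 1) * (n * ‖x‖) := by
      have := ContinuousLinearMap.le_of_opNorm_le _ ((hK n).trans hn) x
      simp only [smul_apply, norm_smul, norm_inv, Real.norm_eq_abs,
        abs_of_pos hn0] at this
      rwa [inv_mul_le_iff₀ hn0] at this
    have h2 : ‖(((n : ℝ) + 1) ^ 2) • x‖ ≤ ‖pathSumOp T n x‖ + C * ‖x - T x‖ := by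
      have := norm_sub_norm_le ((((n : ℝ) + 1) ^ 2) • x) (pathSumOp T n x)
      rw [norm_sub_rev] at this
      linarith [hC x]
    rw [norm_smul, Real.norm_eq_abs, abs_of_pos (by positivity)] at h2
    nlinarith [norm_nonneg x, mul_nonneg (Nat.cast_nonneg (α := ℝ) n) (norm_nonneg x)]
  have h2 (x : H) : ‖x - T x‖ ^ 2 ≤ 2 * (‖x‖ ^ 2 - ⟪x, T x⟫) := by
    rw [norm_sub_sq_real]
    nlinarith [hT1 x, norm_nonneg (T x)]
  -- The `+ 1` covers the case `C = 0`.
  refine ⟨1 / (2 * (C ^ 2 + 1)), by positivity, fun x => ?_⟩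
  rw [one_div, inv_mul_le_iff₀ (by positivity)]
  have h3 : ‖x‖ ^ 2 ≤ C ^ 2 * ‖x - T x‖ ^ 2 := by
    rw [← mul_pow]
    exact pow_le_pow_left₀ (norm_nonneg _) (h1 x) 2
  nlinarith [h2 x, sq_nonneg C, sq_nonneg ‖x - T x‖]

/-- The gap says that the bilinear form of `1 - T` is coercive, so Lax–Milgram applies; symmetry of
`T` is not needed. -/
theorem exists_sub_apply_eq_of_gap [CompleteSpace H] {T : H →L[ℝ] H} {c : ℝ} (hc : 0 < c)
    (hgap : ∀ x, c * ‖x‖ ^ 2 ≤ ‖x‖ ^ 2 - ⟪x, T x⟫) (f : H) : ∃ g, g - T g = f := by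
  let B : H →L[ℝ] H →L[ℝ] ℝ := (innerSL ℝ).comp (1 - T)
  have hB : IsCoercive B := ⟨c, hc, fun u => by
    have h1 := hgap u
    have h2 := real_inner_comm u (T u)
    simp only [B, ContinuousLinearMap.comp_apply, innerSL_apply_apply,
      sub_apply, one_apply_eq_self, inner_sub_left,
      real_inner_self_eq_norm_sq]
    linarith⟩
  refine ⟨hB.continuousLinearEquivOfBilin.symm f, ?_⟩
  refine ext_inner_right ℝ fun w => ?_
  have := hB.continuousLinearEquivOfBilin_apply (hB.continuousLinearEquivOfBilin.symm f) w
  rw [ContinuousLinearEquiv.apply_symm_apply] at this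
  rw [this]
  simp [B, inner_sub_left]

/-- A spectral gap makes the normalized variances converge. -/
theorem exists_tendsto_of_gap [CompleteSpace H] {T : H →L[ℝ] H} (hT1 : ∀ x, ‖T x‖ ≤ ‖x‖)
    {c : ℝ} (hc : 0 < c) (hgap : ∀ x, c * ‖x‖ ^ 2 ≤ ‖x‖ ^ 2 - ⟪x, T x⟫) (f : H) :
    ∃ v : ℝ, Tendsto (fun n : ℕ => ⟪f, pathSumOp T n f⟫ / ((n : ℝ) + 1)) atTop (𝓝 v) := by
  -- Writing `f = (1 - T)² h` makes both nested sums telescope, leaving a multiple of `n + 1` and a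
  -- remainder bounded in `n`.
  obtain ⟨g, rfl⟩ := exists_sub_apply_eq_of_gap hc hgap f
  obtain ⟨h, rfl⟩ := exists_sub_apply_eq_of_gap hc hgap g
  have hpow (k : ℕ) (x : H) : ‖(T ^ k) x‖ ≤ ‖x‖ := by
    induction k generalizing x with
    | zero => simp
    | succ k ih =>
      rw [pow_succ, mul_apply_eq_comp]
      exact (ih _).trans (hT1 x)
  have htel (x : H) (j m : ℕ) : ∑ k ∈ Finset.range m, (T ^ (k + j)) (x - T x) =
      (T ^ j) x - (T ^ (m + j)) x := by
    have hk (k : ℕ) : (T ^ (k + j)) (x - T x) = (T ^ (k + j)) x - (T ^ (k + 1 + j)) x := by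
      rw [map_sub, ← mul_apply_eq_comp, ← pow_succ, add_right_comm]
    simp only [hk]
    rw [Finset.sum_range_sub' (fun k => (T ^ (k + j)) x), zero_add]
  set g := h - T h with hg
  set f := g - T g with hf
  have hsum (n : ℕ) : pathSumOp T n f = ((n : ℝ) + 1) • (f + (2 : ℝ) • T g) -
      (2 : ℝ) • (T g + (T ^ 2) h - (T ^ (n + 2)) h) := by
    have h1 : ∑ m ∈ Finset.range n, ∑ k ∈ Finset.range (m + 1), (T ^ (k + 1)) f =
        (n : ℝ) • T g - ((T ^ 2) h - (T ^ (n + 2)) h) := by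
      rw [← htel h 2 n]
      simp only [hf, htel g 1, add_assoc, Nat.reduceAdd, Finset.sum_sub_distrib, Finset.sum_const,
        Finset.card_range, pow_one, Nat.cast_smul_eq_nsmul, ← hg]
    rw [pathSumOp_apply, h1]
    module
  refine ⟨⟪f, f + (2 : ℝ) • T g⟫, ?_⟩
  have hdiff (n : ℕ) : ⟪f, pathSumOp T n f⟫ / ((n : ℝ) + 1) = ⟪f, f + (2 : ℝ) • T g⟫ -
      2 * ⟪f, T g + (T ^ 2) h - (T ^ (n + 2)) h⟫ * (1 / ((n : ℝ) + 1)) := by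
    have : (n : ℝ) + 1 ≠ 0 := by positivity
    rw [hsum, inner_sub_right, real_inner_smul_right, real_inner_smul_right]
    field_simp
  simp only [hdiff]
  conv => rhs; rw [← sub_zero ⟪f, f + (2 : ℝ) • T g⟫]
  refine tendsto_const_nhds.sub ?_
  refine bdd_le_mul_tendsto_zero' (2 * (‖f‖ * (‖T g‖ + ‖(T ^ 2) h‖ + ‖h‖)))
    (Eventually.of_forall fun n => ?_) tendsto_one_div_add_atTop_nhds_zero_nat
  rw [abs_mul, abs_of_pos (by norm_num : (0 : ℝ) < 2)]
  gcongr
  refine (abs_real_inner_le_norm _ _).trans ?_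
  gcongr
  exact (norm_sub_le _ _).trans (add_le_add (norm_add_le _ _) (hpow _ _))

end Hilbert

/-! ### Action of an invariant Markov kernel on `L²(π)` -/

section KernelMean

variable {α Ω : Type*} [MeasurableSpace α] [MeasurableSpace Ω]

/-- The action `(P f)(x) = ∫ f(y) P(x, dy)` of a kernel on functions. -/
noncomputable def kernelMean (P : Kernel α α) (f : α → ℝ) (x : α) : ℝ := ∫ y, f y ∂(P x)

theorem integral_comp_measurePreserving {μ : Measure Ω} {π : Measure α} {X : Ω → α}
    (hX : MeasurePreserving X μ π) {f : α → ℝ} (hf : AEStronglyMeasurable f π) :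
    ∫ ω, f (X ω) ∂μ = ∫ x, f x ∂π := by
  obtain ⟨hm, rfl⟩ := hX
  exact (integral_map hm.aemeasurable hf).symm

theorem measurePreserving_fst_compProd (μ : Measure Ω) [SFinite μ] (κ : Kernel Ω α)
    [IsMarkovKernel κ] : MeasurePreserving Prod.fst (μ ⊗ₘ κ) μ :=
  ⟨measurable_fst, Measure.fst_compProd μ κ⟩

theorem measurePreserving_snd_compProd_comap {π : Measure α} {P : Kernel α α} [IsMarkovKernel P]
    (hinv : P.Invariant π) {μ : Measure Ω} [SFinite μ] {X : Ω → α}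
    (hX : MeasurePreserving X μ π) :
    MeasurePreserving Prod.snd (μ ⊗ₘ P.comap X hX.measurable) π := by
  refine ⟨measurable_snd, ?_⟩
  change (μ ⊗ₘ P.comap X hX.measurable).snd = π
  rw [Measure.snd_compProd]
  ext s hs
  have h := hinv.def
  rw [← hX.map_eq] at h
  have h2 := congrArg (fun m : Measure α => m s) h
  rw [Measure.bind_apply hs (Kernel.aemeasurable _),
    lintegral_map (Kernel.measurable_coe _ hs) hX.measurable, hX.map_eq] at h2
  rw [Measure.bind_apply hs (Kernel.aemeasurable _), ← h2]
  rfl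

theorem measurePreserving_snd_compProd {π : Measure α} [SFinite π] {P : Kernel α α}
    [IsMarkovKernel P] (hinv : P.Invariant π) : MeasurePreserving Prod.snd (π ⊗ₘ P) π :=
  measurePreserving_snd_compProd_comap hinv (MeasurePreserving.id π)

theorem kernelMean_ae_eq {π : Measure α} [SFinite π] {P : Kernel α α} [IsMarkovKernel P]
    (hinv : P.Invariant π) {f g : α → ℝ} (hfg : f =ᵐ[π] g) :
    kernelMean P f =ᵐ[π] kernelMean P g := by
  have h := (measurePreserving_snd_compProd hinv).quasiMeasurePreserving.ae hfg
  filter_upwards [Measure.ae_ae_of_ae_compProd h] with x hx using integral_congr_ae hx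

/-- Jensen's inequality `(P f)² ≤ P(f²)`, obtained from the nonnegativity of the variance of `f`
under `P x`, combined with invariance. -/
theorem memLp_kernelMean {π : Measure α} [IsProbabilityMeasure π] {P : Kernel α α}
    [IsMarkovKernel P] (hinv : P.Invariant π) {f : α → ℝ} (hf : MemLp f 2 π) :
    MemLp (kernelMean P f) 2 π := by
  have hf2 : MemLp (fun z : α × α => f z.2) 2 (π ⊗ₘ P) :=
    hf.comp_measurePreserving (measurePreserving_snd_compProd hinv)
  have hsq : Integrable (fun z : α × α => f z.2 ^ 2) (π ⊗ₘ P) := hf2.integrable_sq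
  have hm : AEStronglyMeasurable (kernelMean P f) π := by
    have := hf2.1
    rw [Measure.compProd] at this
    change AEStronglyMeasurable (fun x => ∫ y, f y ∂(P x)) π
    simpa using this.integral_kernel_compProd
  have hI : Integrable (fun x => ∫ y, f y ^ 2 ∂(P x)) π := by
    have := hsq
    rw [Measure.compProd] at this
    simpa using this.integral_compProd
  rw [memLp_two_iff_integrable_sq hm]
  refine hI.mono' (hm.pow 2) ?_
  have h1 := (Measure.integrable_compProd_iff hsq.1).1 hsq
  filter_upwards [h1.1, hf2.1.ae_of_compProd (f := fun _ y => f y)] with x hx hxm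
  have hL : MemLp f 2 (P x) := (memLp_two_iff_integrable_sq hxm).2 hx
  have := variance_nonneg f (P x)
  rw [variance_eq_sub hL] at this
  rw [Real.norm_eq_abs, abs_of_nonneg (sq_nonneg _)]
  simp only [Pi.pow_apply] at this
  unfold kernelMean
  linarith

/-- The Markov property in `L²`: given `ω`, the next state is drawn from `P` at `X ω`. -/
theorem integral_mul_next {π : Measure α} {P : Kernel α α} [IsMarkovKernel P]
    (hinv : P.Invariant π) {μ : Measure Ω} [IsFiniteMeasure μ] {X : Ω → α}
    (hX : MeasurePreserving X μ π) {G : Ω → ℝ} (hG : MemLp G 2 μ) {f : α → ℝ}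
    (hf : MemLp f 2 π) :
    ∫ z, G z.1 * f z.2 ∂(μ ⊗ₘ P.comap X hX.measurable) = ∫ ω, G ω * kernelMean P f (X ω) ∂μ := by
  have h1 : MemLp (fun z : Ω × α => G z.1) 2 (μ ⊗ₘ P.comap X hX.measurable) :=
    hG.comp_measurePreserving (measurePreserving_fst_compProd _ _)
  have h2 : MemLp (fun z : Ω × α => f z.2) 2 (μ ⊗ₘ P.comap X hX.measurable) :=
    hf.comp_measurePreserving (measurePreserving_snd_compProd_comap hinv hX)
  have hint : Integrable (fun z : Ω × α => G z.1 * f z.2) (μ ⊗ₘ P.comap X hX.measurable) :=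
    h1.integrable_mul h2
  rw [Measure.integral_compProd hint]
  simp only [Kernel.comap_apply, integral_const_mul, kernelMean]

theorem integral_mul_snd_compProd {π : Measure α} [IsFiniteMeasure π] {P : Kernel α α}
    [IsMarkovKernel P] (hinv : P.Invariant π) {f g : α → ℝ} (hf : MemLp f 2 π)
    (hg : MemLp g 2 π) :
    ∫ z, g z.1 * f z.2 ∂(π ⊗ₘ P) = ∫ x, g x * kernelMean P f x ∂π :=
  integral_mul_next hinv (MeasurePreserving.id π) hg hf

end KernelMean

/-! ### Second moments of partial sums along the stationary chain -/

section Path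

variable {α : Type*} [MeasurableSpace α]

theorem measurable_snoc (n : ℕ) :
    Measurable (fun p : (Fin (n + 1) → α) × α => (Fin.snoc p.1 p.2 : Fin (n + 2) → α)) := by
  refine measurable_pi_iff.2 fun i => ?_
  refine Fin.lastCases ?_ (fun j => ?_) i
  · simpa using measurable_snd
  · simpa [Function.comp_def] using (measurable_pi_apply j).comp measurable_fst

theorem integral_chainLaw_zero {π : Measure α} {P : Kernel α α} (F : (Fin 1 → α) → ℝ)
    (hF : AEStronglyMeasurable F (chainLaw P π 0)) :
    ∫ ω, F ω ∂(chainLaw P π 0) = ∫ x, F (fun _ => x) ∂π := by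
  rw [chainLaw] at hF ⊢
  exact integral_map (by fun_prop) hF

theorem integral_chainLaw_succ {π : Measure α} {P : Kernel α α} (n : ℕ) (F : (Fin (n + 2) → α) → ℝ)
    (hF : AEStronglyMeasurable F (chainLaw P π (n + 1))) :
    ∫ ω, F ω ∂(chainLaw P π (n + 1)) = ∫ p, F (Fin.snoc p.1 p.2 : Fin (n + 2) → α)
      ∂(chainLaw P π n ⊗ₘ
        P.comap (fun ω : Fin (n + 1) → α => ω (Fin.last n)) (measurable_pi_apply _)) := by
  rw [chainLaw] at hF ⊢
  exact integral_map (measurable_snoc n).aemeasurable hF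

variable {π : Measure α} [IsProbabilityMeasure π] {P : Kernel α α} [IsMarkovKernel P]

instance isProbabilityMeasure_chainLaw (n : ℕ) : IsProbabilityMeasure (chainLaw P π n) := by
  induction n with
  | zero => exact Measure.isProbabilityMeasure_map (by fun_prop)
  | succ n ih => exact Measure.isProbabilityMeasure_map (measurable_snoc n).aemeasurable

theorem measurePreserving_eval_chainLaw (hinv : P.Invariant π) (n : ℕ) (i : Fin (n + 1)) :
    MeasurePreserving (fun ω : Fin (n + 1) → α => ω i) (chainLaw P π n) π := by
  refine ⟨measurable_pi_apply i, ?_⟩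
  induction n with
  | zero =>
    rw [chainLaw, Measure.map_map (measurable_pi_apply i) (by fun_prop)]
    exact Measure.map_id
  | succ n ih =>
    rw [chainLaw, Measure.map_map (measurable_pi_apply i) (measurable_snoc n)]
    refine Fin.lastCases ?_ (fun j => ?_) i
    · have h := measurePreserving_snd_compProd_comap hinv
        ⟨measurable_pi_apply (Fin.last n), ih (Fin.last n)⟩
      convert h.map_eq using 2
      ext p
      simp
    · have h := measurePreserving_fst_compProd (chainLaw P π n)
        (P.comap (fun ω : Fin (n + 1) → α => ω (Fin.last n)) (measurable_pi_apply _))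
      convert ih j using 1
      conv_rhs => rw [← h.map_eq, Measure.map_map (measurable_pi_apply j) measurable_fst]
      congr 1
      ext p
      simp

theorem memLp_eval_chainLaw (hinv : P.Invariant π) {f : α → ℝ} (hf : MemLp f 2 π) (n : ℕ)
    (i : Fin (n + 1)) : MemLp (fun ω : Fin (n + 1) → α => f (ω i)) 2 (chainLaw P π n) :=
  hf.comp_measurePreserving (measurePreserving_eval_chainLaw hinv n i)

theorem memLp_sum_chainLaw (hinv : P.Invariant π) {f : α → ℝ} (hf : MemLp f 2 π) (n : ℕ) :
    MemLp (fun ω : Fin (n + 1) → α => ∑ i, f (ω i)) 2 (chainLaw P π n) :=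
  memLp_finsetSum _ fun i _ => memLp_eval_chainLaw hinv hf n i

/-- Conditioning on all but the last state replaces `g` there by `P g` one step earlier, hence the
induction over all `g`. The last summand of the path sum supplies the term `k = 0`. -/
theorem integral_sum_mul_last (hinv : P.Invariant π) {f g : α → ℝ} (hf : MemLp f 2 π)
    (hg : MemLp g 2 π) (n : ℕ) :
    ∫ ω, (∑ i, f (ω i)) * g (ω (Fin.last n)) ∂(chainLaw P π n) =
      ∑ k ∈ Finset.range (n + 1), ∫ x, f x * (kernelMean P)^[k] g x ∂π := by
  induction n generalizing g with
  | zero =>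
    rw [integral_chainLaw_zero]
    · simp
    · exact ((memLp_sum_chainLaw hinv hf 0).1.mul (memLp_eval_chainLaw hinv hg 0 _).1)
  | succ n ih =>
    have hL := measurePreserving_eval_chainLaw hinv n (Fin.last n)
    rw [integral_chainLaw_succ]
    · simp only [Fin.sum_univ_castSucc (n := n + 1), Fin.snoc_castSucc, Fin.snoc_last, add_mul]
      have hsnd := measurePreserving_snd_compProd_comap hinv hL
      have h1 := (memLp_sum_chainLaw hinv hf n).comp_measurePreserving
        (measurePreserving_fst_compProd _
          (P.comap (fun ω : Fin (n + 1) → α => ω (Fin.last n)) (measurable_pi_apply _)))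
      have hg' := hg.comp_measurePreserving hsnd
      have hf' := hf.comp_measurePreserving hsnd
      have hlast : ∫ z, f z.2 * g z.2 ∂(chainLaw P π n ⊗ₘ
          P.comap (fun ω : Fin (n + 1) → α => ω (Fin.last n)) (measurable_pi_apply _)) =
          ∫ x, f x * g x ∂π :=
        integral_comp_measurePreserving hsnd (hf.1.mul hg.1)
      have i1 : Integrable (fun z : (Fin (n + 1) → α) × α => (∑ i, f (z.1 i)) * g z.2)
        (chainLaw P π n ⊗ₘ P.comap _ (measurable_pi_apply (Fin.last n))) := h1.integrable_mul hg'
      have i2 : Integrable (fun z : (Fin (n + 1) → α) × α => f z.2 * g z.2)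
        (chainLaw P π n ⊗ₘ P.comap _ (measurable_pi_apply (Fin.last n))) := hf'.integrable_mul hg'
      rw [integral_add i1 i2, hlast,
        integral_mul_next hinv hL (memLp_sum_chainLaw hinv hf n) hg,
        ih (memLp_kernelMean hinv hg), Finset.sum_range_succ' _ (n + 1)]
      rfl
    · exact (memLp_sum_chainLaw hinv hf (n + 1)).1.mul (memLp_eval_chainLaw hinv hg (n + 1) _).1

/-- Expand `(S + f(X))²` for the new state `X`: the cross term is an instance of
`integral_sum_mul_last` applied to `P f`, and contributes the summand `m = n`. -/
theorem integral_sum_sq (hinv : P.Invariant π) {f : α → ℝ} (hf : MemLp f 2 π) (n : ℕ) :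
    ∫ ω, (∑ i, f (ω i)) ^ 2 ∂(chainLaw P π n) = ((n : ℝ) + 1) * ∫ x, f x * f x ∂π +
      2 * ∑ m ∈ Finset.range n, ∑ k ∈ Finset.range (m + 1),
        ∫ x, f x * (kernelMean P)^[k + 1] f x ∂π := by
  induction n with
  | zero =>
    rw [integral_chainLaw_zero]
    · simp [sq]
    · exact (memLp_sum_chainLaw hinv hf 0).1.pow 2
  | succ n ih =>
    have hL := measurePreserving_eval_chainLaw hinv n (Fin.last n)
    have hfst := measurePreserving_fst_compProd (chainLaw P π n)
      (P.comap (fun ω : Fin (n + 1) → α => ω (Fin.last n)) (measurable_pi_apply _))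
    have hsnd := measurePreserving_snd_compProd_comap hinv hL
    have hS := memLp_sum_chainLaw hinv hf n
    have h1 := hS.comp_measurePreserving hfst
    have hf' := hf.comp_measurePreserving hsnd
    rw [integral_chainLaw_succ n (fun ω => (∑ i, f (ω i)) ^ 2)
      ((memLp_sum_chainLaw hinv hf (n + 1)).1.pow 2)]
    simp only [Fin.sum_univ_castSucc (n := n + 1), Fin.snoc_castSucc, Fin.snoc_last]
    have hlast : ∫ z, f z.2 * f z.2 ∂(chainLaw P π n ⊗ₘ
        P.comap (fun ω : Fin (n + 1) → α => ω (Fin.last n)) (measurable_pi_apply _)) =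
        ∫ x, f x * f x ∂π :=
      integral_comp_measurePreserving hsnd (hf.1.mul hf.1)
    have hfirst : ∫ z, (∑ i, f (z.1 i)) ^ 2 ∂(chainLaw P π n ⊗ₘ
        P.comap (fun ω : Fin (n + 1) → α => ω (Fin.last n)) (measurable_pi_apply _)) =
        ∫ ω, (∑ i, f (ω i)) ^ 2 ∂(chainLaw P π n) :=
      integral_comp_measurePreserving hfst (hS.1.pow 2)
    have hcross := integral_mul_next hinv hL hS hf
    rw [integral_sum_mul_last hinv hf (memLp_kernelMean hinv hf)] at hcross
    have hexp (z : (Fin (n + 1) → α) × α) : (∑ i, f (z.1 i) + f z.2) ^ 2 =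
        (∑ i, f (z.1 i)) ^ 2 + 2 * ((∑ i, f (z.1 i)) * f z.2) + f z.2 * f z.2 := by ring
    simp only [hexp]
    have i1 : Integrable (fun z : (Fin (n + 1) → α) × α => (∑ i, f (z.1 i)) ^ 2)
      (chainLaw P π n ⊗ₘ P.comap _ (measurable_pi_apply (Fin.last n))) := h1.integrable_sq
    have i2 : Integrable (fun z : (Fin (n + 1) → α) × α => 2 * ((∑ i, f (z.1 i)) * f z.2))
      (chainLaw P π n ⊗ₘ P.comap _ (measurable_pi_apply (Fin.last n))) :=
      (h1.integrable_mul hf').const_mul 2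
    have i3 : Integrable (fun z : (Fin (n + 1) → α) × α => f z.2 * f z.2)
      (chainLaw P π n ⊗ₘ P.comap _ (measurable_pi_apply (Fin.last n))) := hf'.integrable_mul hf'
    have i12 : Integrable (fun z : (Fin (n + 1) → α) × α =>
      (∑ i, f (z.1 i)) ^ 2 + 2 * ((∑ i, f (z.1 i)) * f z.2))
      (chainLaw P π n ⊗ₘ P.comap _ (measurable_pi_apply (Fin.last n))) := i1.add i2
    rw [integral_add i12 i3, integral_add i1 i2, integral_const_mul, hfirst, ih, hlast,
      hcross, Finset.sum_range_succ
        (fun m => ∑ k ∈ Finset.range (m + 1), ∫ x, f x * (kernelMean P)^[k + 1] f x ∂π) n]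
    simp only [Function.iterate_succ_apply]
    push_cast
    ring

theorem integral_sum_chainLaw (hinv : P.Invariant π) {f : α → ℝ} (hf : MemLp f 2 π) (n : ℕ) :
    ∫ ω, ∑ i, f (ω i) ∂(chainLaw P π n) = ((n : ℝ) + 1) * ∫ x, f x ∂π := by
  rw [integral_finsetSum _ fun i _ => (memLp_eval_chainLaw hinv hf n i).integrable one_le_two]
  have h (i : Fin (n + 1)) : ∫ ω, f (ω i) ∂(chainLaw P π n) = ∫ x, f x ∂π :=
    integral_comp_measurePreserving (measurePreserving_eval_chainLaw hinv n i) hf.1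
  simp [h]

theorem scaledVariance_eq (hinv : P.Invariant π) {f : α → ℝ} (hf : MemLp f 2 π)
    (hf0 : ∫ x, f x ∂π = 0) (n : ℕ) :
    scaledVariance f P π n = (((n : ℝ) + 1) * ∫ x, f x * f x ∂π +
      2 * ∑ m ∈ Finset.range n, ∑ k ∈ Finset.range (m + 1),
        ∫ x, f x * (kernelMean P)^[k + 1] f x ∂π) / ((n : ℝ) + 1) := by
  have hn : ((n : ℝ) + 1) ≠ 0 := by positivity
  rw [scaledVariance, variance_const_mul,
    variance_of_integral_eq_zero (memLp_sum_chainLaw hinv hf n).1.aemeasurable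
      (by rw [integral_sum_chainLaw hinv hf, hf0, mul_zero]),
    integral_sum_sq hinv hf]
  field_simp

theorem scaledVariance_add_const (hinv : P.Invariant π) {f : α → ℝ} (hf : MemLp f 2 π) (c : ℝ)
    (n : ℕ) : scaledVariance (fun x => f x + c) P π n = scaledVariance f P π n := by
  simp only [scaledVariance, variance_const_mul, Finset.sum_add_distrib, Finset.sum_const]
  rw [variance_add_const (memLp_sum_chainLaw hinv hf n).1]

end Path

/-! ### Variance bounding as a spectral gap and as a Poincaré inequality -/

section SpectralGap

variable {α : Type*} [MeasurableSpace α]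

local notation "⟪" x ", " y "⟫" => inner ℝ x y

theorem lintegral_enorm_sq_eq_ofReal {μ : Measure α} {f : α → ℝ} (hf : MemLp f 2 μ) :
    ∫⁻ x, ‖f x‖ₑ ^ 2 ∂μ = ENNReal.ofReal (∫ x, f x ^ 2 ∂μ) := by
  rw [ofReal_integral_eq_lintegral_ofReal hf.integrable_sq (ae_of_all _ fun x => sq_nonneg _)]
  refine lintegral_congr fun x => ?_
  rw [Real.enorm_eq_ofReal_abs, ← ENNReal.ofReal_pow (abs_nonneg _), sq_abs]

/-- The mean-zero functions in `L²(π)`. -/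
noncomputable def meanZeroL2 (π : Measure α) [IsFiniteMeasure π] : Submodule ℝ (Lp ℝ 2 π) :=
  (ℝ ∙ indicatorConstLp 2 MeasurableSet.univ (measure_ne_top π _) (1 : ℝ))ᗮ

noncomputable instance instCompleteSpaceMeanZeroL2 (π : Measure α) [IsFiniteMeasure π] :
    CompleteSpace (meanZeroL2 π) :=
  Submodule.instOrthogonalCompleteSpace _

theorem mem_meanZeroL2 {π : Measure α} [IsFiniteMeasure π] {f : Lp ℝ 2 π} :
    f ∈ meanZeroL2 π ↔ ∫ x, f x ∂π = 0 := by
  rw [meanZeroL2, Submodule.mem_orthogonal_singleton_iff_inner_right,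
    L2.inner_indicatorConstLp_one, setIntegral_univ]

theorem toLp_mem_meanZeroL2 {π : Measure α} [IsFiniteMeasure π] {f : α → ℝ} (hf : MemLp f 2 π)
    (hf0 : ∫ x, f x ∂π = 0) : hf.toLp f ∈ meanZeroL2 π := by
  rw [mem_meanZeroL2, integral_congr_ae hf.coeFn_toLp, hf0]

theorem inner_L2_eq {μ : Measure α} (f g : Lp ℝ 2 μ) : ⟪f, g⟫ = ∫ x, f x * g x ∂μ := by
  rw [L2.inner_def]
  exact integral_congr_ae (ae_of_all _ fun x => by simp [mul_comm])

theorem norm_sq_L2_eq {μ : Measure α} (f : Lp ℝ 2 μ) : ‖f‖ ^ 2 = ∫ x, f x ^ 2 ∂μ := by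
  rw [← real_inner_self_eq_norm_sq, inner_L2_eq]
  simp only [sq]

variable {π : Measure α} [IsProbabilityMeasure π] {P : Kernel α α} [IsMarkovKernel P]

/-- The embedding `f ↦ f(X₁)` in `L²` of the joint law of two successive states. -/
noncomputable def embedFst (π : Measure α) [IsProbabilityMeasure π] (P : Kernel α α)
    [IsMarkovKernel P] : meanZeroL2 π →ₗᵢ[ℝ] Lp ℝ 2 (π ⊗ₘ P) :=
  (Lp.compMeasurePreservingₗᵢ ℝ Prod.fst (measurePreserving_fst_compProd π P)).comp
    (meanZeroL2 π).subtypeₗᵢ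

/-- The embedding `f ↦ f(X₂)` in `L²` of the joint law of two successive states. -/
noncomputable def embedSnd (hinv : P.Invariant π) : meanZeroL2 π →ₗᵢ[ℝ] Lp ℝ 2 (π ⊗ₘ P) :=
  (Lp.compMeasurePreservingₗᵢ ℝ Prod.snd (measurePreserving_snd_compProd hinv)).comp
    (meanZeroL2 π).subtypeₗᵢ

/-- The transition operator on mean-zero functions in `L²(π)`: the pairing of `f(X₁)` with
`g(X₂)` in the joint law of two successive states. -/
noncomputable def transitionOp (hinv : P.Invariant π) : meanZeroL2 π →L[ℝ] meanZeroL2 π :=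
  -- An isometry followed by the adjoint of an isometry: independence of representatives and
  -- contractivity come for free.
  (embedFst π P).toContinuousLinearMap.adjoint ∘L (embedSnd hinv).toContinuousLinearMap

theorem inner_transitionOp (hinv : P.Invariant π) (f g : meanZeroL2 π) :
    ⟪g, transitionOp hinv f⟫ = ∫ z, (g : Lp ℝ 2 π) z.1 * (f : Lp ℝ 2 π) z.2 ∂(π ⊗ₘ P) := by
  rw [transitionOp, ContinuousLinearMap.comp_apply, ContinuousLinearMap.adjoint_inner_right,
    inner_L2_eq]
  refine integral_congr_ae ?_
  have h1 := Lp.coeFn_compMeasurePreserving (g : Lp ℝ 2 π) (measurePreserving_fst_compProd π P)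
  have h2 := Lp.coeFn_compMeasurePreserving (f : Lp ℝ 2 π) (measurePreserving_snd_compProd hinv)
  filter_upwards [h1, h2] with z h1 h2
  exact congrArg₂ (· * ·) h1 h2

theorem norm_transitionOp_le (hinv : P.Invariant π) (f : meanZeroL2 π) :
    ‖transitionOp hinv f‖ ≤ ‖f‖ := by
  refine (ContinuousLinearMap.le_opNorm (embedFst π P).toContinuousLinearMap.adjoint _).trans ?_
  rw [LinearIsometryEquiv.norm_map]
  refine (mul_le_of_le_one_left (norm_nonneg _)
    (embedFst π P).norm_toContinuousLinearMap_le).trans ?_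
  exact ((embedSnd hinv).norm_map f).le

theorem invariant_of_map_swap (hrev : (π ⊗ₘ P).map Prod.swap = π ⊗ₘ P) : P.Invariant π := by
  rw [Kernel.Invariant, ← Measure.snd_compProd, Measure.snd, ← hrev,
    Measure.map_map measurable_snd measurable_swap]
  exact Measure.fst_compProd π P

theorem transitionOp_symm (hrev : (π ⊗ₘ P).map Prod.swap = π ⊗ₘ P) (hinv : P.Invariant π)
    (f g : meanZeroL2 π) : ⟪transitionOp hinv f, g⟫ = ⟪f, transitionOp hinv g⟫ := by
  rw [real_inner_comm, inner_transitionOp, inner_transitionOp]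
  conv_rhs => rw [← hrev]
  rw [integral_map measurable_swap.aemeasurable]
  · simp only [Prod.fst_swap, Prod.snd_swap, mul_comm]
  · rw [hrev]
    exact ((Lp.memLp (f : Lp ℝ 2 π)).comp_measurePreserving
        (measurePreserving_fst_compProd π P)).1.mul
      ((Lp.memLp (g : Lp ℝ 2 π)).comp_measurePreserving (measurePreserving_snd_compProd hinv)).1

theorem integral_kernelMean (hinv : P.Invariant π) {f : α → ℝ} (hf : MemLp f 2 π) :
    ∫ x, kernelMean P f x ∂π = ∫ x, f x ∂π := by
  have h := integral_mul_snd_compProd hinv hf (memLp_const (1 : ℝ))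
  simp only [one_mul] at h
  rw [← h]
  exact integral_comp_measurePreserving (measurePreserving_snd_compProd hinv) hf.1

/-- Both sides have the same inner product with every mean-zero `g`, and `P f` is itself mean-zero
by invariance. -/
theorem coe_transitionOp (hinv : P.Invariant π) (f : meanZeroL2 π) :
    ((transitionOp hinv f : meanZeroL2 π) : Lp ℝ 2 π) =ᵐ[π] kernelMean P (f : Lp ℝ 2 π) := by
  have hm := memLp_kernelMean hinv (Lp.memLp (f : Lp ℝ 2 π))
  have hmem := toLp_mem_meanZeroL2 hm (by
    rw [integral_kernelMean hinv (Lp.memLp (f : Lp ℝ 2 π))]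
    exact mem_meanZeroL2.1 f.2)
  have heq : transitionOp hinv f = ⟨hm.toLp _, hmem⟩ := by
    refine ext_inner_left ℝ fun g => ?_
    rw [inner_transitionOp,
      integral_mul_snd_compProd hinv (Lp.memLp (f : Lp ℝ 2 π)) (Lp.memLp (g : Lp ℝ 2 π)),
      Submodule.coe_inner, inner_L2_eq]
    refine integral_congr_ae ?_
    filter_upwards [hm.coeFn_toLp] with x hx
    rw [hx]
  rw [heq]
  exact hm.coeFn_toLp

theorem coe_transitionOp_pow (hinv : P.Invariant π) (f : meanZeroL2 π) (k : ℕ) :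
    (((transitionOp hinv ^ k) f : meanZeroL2 π) : Lp ℝ 2 π) =ᵐ[π]
      (kernelMean P)^[k] (f : Lp ℝ 2 π) := by
  induction k with
  | zero => rfl
  | succ k ih =>
    rw [pow_succ', mul_apply_eq_comp, Function.iterate_succ_apply']
    exact (coe_transitionOp hinv _).trans (kernelMean_ae_eq hinv ih)

theorem scaledVariance_coe (hinv : P.Invariant π) (f : meanZeroL2 π) (n : ℕ) :
    scaledVariance (f : Lp ℝ 2 π) P π n =
      ⟪f, pathSumOp (transitionOp hinv) n f⟫ / ((n : ℝ) + 1) := by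
  have e0 : ∫ x, (f : Lp ℝ 2 π) x * (f : Lp ℝ 2 π) x ∂π = ⟪f, f⟫ := by
    rw [Submodule.coe_inner, inner_L2_eq]
  have e (k : ℕ) : ∫ x, (f : Lp ℝ 2 π) x * (kernelMean P)^[k] (f : Lp ℝ 2 π) x ∂π =
      ⟪f, (transitionOp hinv ^ k) f⟫ := by
    rw [Submodule.coe_inner, inner_L2_eq]
    refine integral_congr_ae ?_
    filter_upwards [coe_transitionOp_pow hinv f k] with x hx
    rw [hx]
  rw [scaledVariance_eq hinv (Lp.memLp (f : Lp ℝ 2 π)) (mem_meanZeroL2.1 f.2), pathSumOp_apply,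
    inner_add_right, real_inner_smul_right, real_inner_smul_right]
  simp only [inner_sum, e0, e]

theorem scaledVariance_congr_ae (hinv : P.Invariant π) {f g : α → ℝ} (hfg : f =ᵐ[π] g) (n : ℕ) :
    scaledVariance f P π n = scaledVariance g P π n := by
  have h (i : Fin (n + 1)) :=
    (measurePreserving_eval_chainLaw hinv n i).quasiMeasurePreserving.ae hfg
  rw [scaledVariance, scaledVariance]
  refine congrArg _ (variance_congr ?_)
  filter_upwards [ae_all_iff.2 h] with ω hω
  simp only [hω]

/-- For a reversible chain, variance bounding is the existence of a spectral gap of the transition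
operator to the left of `1`. -/
theorem varianceBounding_iff_transitionOp (hrev : (π ⊗ₘ P).map Prod.swap = π ⊗ₘ P)
    (hinv : P.Invariant π) :
    VarianceBounding P π ↔
      ∃ c : ℝ, 0 < c ∧ ∀ f, c * ‖f‖ ^ 2 ≤ ‖f‖ ^ 2 - ⟪f, transitionOp hinv f⟫ := by
  refine ⟨fun hVB => ?_, fun ⟨c, hc, hgap⟩ f hf => ?_⟩
  · refine exists_gap_of_bounded (transitionOp_symm hrev hinv) (norm_transitionOp_le hinv)
      fun f => ?_
    obtain ⟨v, hv⟩ := hVB _ (Lp.memLp (f : Lp ℝ 2 π))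
    -- Of the convergence only boundedness is used.
    obtain ⟨C, hC⟩ := hv.abs.bddAbove_range
    refine ⟨C, fun n => ?_⟩
    rw [← scaledVariance_coe hinv]
    exact hC ⟨n, rfl⟩
  -- Centering `f` leaves all the variances unchanged.
  · have hg : MemLp (fun x => f x + -∫ x, f x ∂π) 2 π := hf.add (memLp_const _)
    have hg0 : ∫ x, (f x + -∫ x, f x ∂π) ∂π = 0 := by
      rw [integral_add (hf.integrable one_le_two) (integrable_const _)]
      simp
    obtain ⟨v, hv⟩ := exists_tendsto_of_gap (norm_transitionOp_le hinv) hc hgap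
      ⟨hg.toLp _, toLp_mem_meanZeroL2 hg hg0⟩
    refine ⟨v, hv.congr fun n => ?_⟩
    rw [← scaledVariance_coe hinv, scaledVariance_congr_ae hinv hg.coeFn_toLp,
      scaledVariance_add_const hinv hf]

/-- The Dirichlet form as an integral over pairs of successive states. -/
theorem norm_sq_sub_inner_transitionOp (hinv : P.Invariant π) (f : meanZeroL2 π) :
    2 * (‖f‖ ^ 2 - ⟪f, transitionOp hinv f⟫) =
      ∫ z, ((f : Lp ℝ 2 π) z.1 - (f : Lp ℝ 2 π) z.2) ^ 2 ∂(π ⊗ₘ P) := by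
  have hf := Lp.memLp (f : Lp ℝ 2 π)
  have m1 := measurePreserving_fst_compProd π P
  have m2 := measurePreserving_snd_compProd hinv
  have h1 := hf.comp_measurePreserving m1
  have h2 := hf.comp_measurePreserving m2
  have e1 : ∫ z, (f : Lp ℝ 2 π) z.1 ^ 2 ∂(π ⊗ₘ P) = ‖f‖ ^ 2 := by
    rw [Submodule.coe_norm, norm_sq_L2_eq]
    exact integral_comp_measurePreserving m1 (hf.1.pow 2)
  have e2 : ∫ z, (f : Lp ℝ 2 π) z.2 ^ 2 ∂(π ⊗ₘ P) = ‖f‖ ^ 2 := by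
    rw [Submodule.coe_norm, norm_sq_L2_eq]
    exact integral_comp_measurePreserving m2 (hf.1.pow 2)
  have i1 : Integrable (fun z : α × α => (f : Lp ℝ 2 π) z.1 ^ 2) (π ⊗ₘ P) := h1.integrable_sq
  have i2 : Integrable (fun z : α × α => (f : Lp ℝ 2 π) z.2 ^ 2) (π ⊗ₘ P) := h2.integrable_sq
  have i3 : Integrable (fun z : α × α => 2 * ((f : Lp ℝ 2 π) z.1 * (f : Lp ℝ 2 π) z.2))
    (π ⊗ₘ P) := (h1.integrable_mul h2).const_mul 2
  have i12 : Integrable (fun z : α × α => (f : Lp ℝ 2 π) z.1 ^ 2 + (f : Lp ℝ 2 π) z.2 ^ 2)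
    (π ⊗ₘ P) := i1.add i2
  have hexp (z : α × α) : ((f : Lp ℝ 2 π) z.1 - (f : Lp ℝ 2 π) z.2) ^ 2 =
      (f : Lp ℝ 2 π) z.1 ^ 2 + (f : Lp ℝ 2 π) z.2 ^ 2 -
        2 * ((f : Lp ℝ 2 π) z.1 * (f : Lp ℝ 2 π) z.2) := by ring
  simp only [hexp]
  rw [integral_sub i12 i3, integral_add i1 i2, integral_const_mul, e1, e2, inner_transitionOp]
  ring

theorem memLp_sub_compProd (hinv : P.Invariant π) {f : α → ℝ} (hf : MemLp f 2 π) :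
    MemLp (fun z : α × α => f z.1 - f z.2) 2 (π ⊗ₘ P) :=
  (hf.comp_measurePreserving (measurePreserving_fst_compProd π P)).sub
    (hf.comp_measurePreserving (measurePreserving_snd_compProd hinv))

/-- For a reversible chain, variance bounding is a Poincaré inequality. -/
theorem varianceBounding_iff_poincare (hrev : (π ⊗ₘ P).map Prod.swap = π ⊗ₘ P) :
    VarianceBounding P π ↔ ∃ c : ℝ≥0, 0 < c ∧ ∀ f : α → ℝ, Measurable f → MemLp f 2 π →
      ∫ x, f x ∂π = 0 →
        (c : ℝ≥0∞) * ∫⁻ x, ‖f x‖ₑ ^ 2 ∂π ≤ ∫⁻ z, ‖f z.1 - f z.2‖ₑ ^ 2 ∂(π ⊗ₘ P) := by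
  have hinv := invariant_of_map_swap hrev
  rw [varianceBounding_iff_transitionOp hrev hinv]
  -- The mean squared increment is twice the Dirichlet form, so a gap `c` corresponds to the
  -- Poincaré constant `2 * c`.
  have hkey (c : ℝ) (hc : 0 < c) (f : meanZeroL2 π) :
      (ENNReal.ofReal (2 * c)) * ∫⁻ x, ‖(f : Lp ℝ 2 π) x‖ₑ ^ 2 ∂π ≤
        ∫⁻ z, ‖(f : Lp ℝ 2 π) z.1 - (f : Lp ℝ 2 π) z.2‖ₑ ^ 2 ∂(π ⊗ₘ P) ↔
      c * ‖f‖ ^ 2 ≤ ‖f‖ ^ 2 - ⟪f, transitionOp hinv f⟫ := by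
    have hf := Lp.memLp (f : Lp ℝ 2 π)
    rw [lintegral_enorm_sq_eq_ofReal hf, lintegral_enorm_sq_eq_ofReal (memLp_sub_compProd hinv hf),
      ← ENNReal.ofReal_mul (by positivity),
      ENNReal.ofReal_le_ofReal_iff (integral_nonneg fun z => sq_nonneg _),
      ← norm_sq_sub_inner_transitionOp hinv, ← norm_sq_L2_eq, Submodule.coe_norm]
    constructor <;> intro h <;> linarith
  constructor
  · rintro ⟨c, hc, h⟩
    refine ⟨(2 * c).toNNReal, by simpa using hc, fun f _ hf hf0 => ?_⟩
    have := (hkey c hc ⟨hf.toLp _, toLp_mem_meanZeroL2 hf hf0⟩).2 (h _)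
    have hae := hf.coeFn_toLp
    have h1 := (measurePreserving_fst_compProd π P).quasiMeasurePreserving.ae hae
    have h2 := (measurePreserving_snd_compProd hinv).quasiMeasurePreserving.ae hae
    convert this using 1
    · refine congrArg _ (lintegral_congr_ae ?_)
      filter_upwards [hae] with x hx
      rw [hx]
    · refine lintegral_congr_ae ?_
      filter_upwards [h1, h2] with x h1 h2
      rw [h1, h2]
  · rintro ⟨c, hc, h⟩
    refine ⟨c / 2, by positivity, fun f => ?_⟩
    rw [← hkey _ (by positivity), mul_div_cancel₀ _ two_ne_zero, ENNReal.ofReal_coe_nnreal]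
    exact h _ (Lp.stronglyMeasurable _).measurable (Lp.memLp _) (mem_meanZeroL2.1 f.2)

end SpectralGap

/-! ### Propose-accept-reject kernels: reversibility and comparison -/

section ParKernel

variable {α : Type*} [MeasurableSpace α] {vol : Measure α}

theorem lintegral_parKernel [SFinite vol] {q : α → α → ℝ≥0} (hq : Measurable (Function.uncurry q))
    {a : α → α → ℝ≥0∞} (ha : Measurable (Function.uncurry a)) {F : α → ℝ≥0∞} (hF : Measurable F)
    (x : α) :
    ∫⁻ y, F y ∂(parKernel vol q a x) = ∫⁻ y, q x y * a x y * F y ∂vol +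
      (1 - ∫⁻ z, (q x z : ℝ≥0∞) * a x z ∂vol) * F x := by
  have hqa : Measurable (Function.uncurry fun x y => (q x y : ℝ≥0∞) * a x y) :=
    hq.coe_nnreal_ennreal.mul ha
  have hrej : Measurable (Function.uncurry fun (x _ : α) =>
      1 - ∫⁻ z, (q x z : ℝ≥0∞) * a x z ∂vol) :=
    (measurable_const.sub hqa.lintegral_prod_right').comp measurable_fst
  rw [parKernel, FunLike.coe_add, Pi.add_apply, lintegral_add_measure,
    Kernel.lintegral_withDensity _ hqa _ hF, Kernel.lintegral_withDensity _ hrej _ hF]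
  simp only [Kernel.const_apply, Kernel.id_apply]
  congr 1
  exact lintegral_dirac' x (f := fun y => (1 - ∫⁻ z, (q x z : ℝ≥0∞) * a x z ∂vol) * F y)
    (measurable_const.mul hF)

theorem isMarkovKernel_parKernel [SFinite vol] {q : α → α → ℝ≥0}
    (hq : Measurable (Function.uncurry q)) (hq_one : ∀ x, ∫⁻ y, (q x y : ℝ≥0∞) ∂vol = 1)
    {a : α → α → ℝ≥0∞} (ha : Measurable (Function.uncurry a)) (ha1 : ∀ x y, a x y ≤ 1) :
    IsMarkovKernel (parKernel vol q a) := by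
  refine ⟨fun x => ⟨?_⟩⟩
  have h := lintegral_parKernel (vol := vol) hq ha measurable_const (F := fun _ => 1) x
  simp only [lintegral_one, mul_one] at h
  rw [h]
  refine add_tsub_cancel_of_le ((lintegral_mono fun y => ?_).trans (hq_one x).le)
  exact mul_le_of_le_one_right' (ha1 x y)

/-- The rate `π(x) q(x, y) a(x, y)` of accepted moves from `x` to `y`. -/
noncomputable def flow (p : α → ℝ≥0) (q : α → α → ℝ≥0) (a : α → α → ℝ≥0∞) (z : α × α) : ℝ≥0∞ :=
  p z.1 * q z.1 z.2 * a z.1 z.2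

theorem measurable_flow {p : α → ℝ≥0} (hp : Measurable p) {q : α → α → ℝ≥0}
    (hq : Measurable (Function.uncurry q)) {a : α → α → ℝ≥0∞}
    (ha : Measurable (Function.uncurry a)) : Measurable (flow p q a) :=
  ((hp.comp measurable_fst).coe_nnreal_ennreal.mul hq.coe_nnreal_ennreal).mul ha

variable [SigmaFinite vol] {p : α → ℝ≥0} {q : α → α → ℝ≥0} {a b : α → α → ℝ≥0∞}

theorem lintegral_compProd_parKernel (hp : Measurable p) (hq : Measurable (Function.uncurry q))
    (hq_one : ∀ x, ∫⁻ y, (q x y : ℝ≥0∞) ∂vol = 1)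
    (ha : Measurable (Function.uncurry a)) (ha1 : ∀ x y, a x y ≤ 1) {G : α × α → ℝ≥0∞}
    (hG : Measurable G) :
    ∫⁻ z, G z ∂(vol.withDensity (fun x => (p x : ℝ≥0∞)) ⊗ₘ parKernel vol q a) =
      ∫⁻ z, flow p q a z * G z ∂(vol.prod vol) +
      ∫⁻ x, p x * ((1 - ∫⁻ z, (q x z : ℝ≥0∞) * a x z ∂vol) * G (x, x)) ∂vol := by
  have := isMarkovKernel_parKernel (vol := vol) hq hq_one ha ha1
  have hqa : Measurable (Function.uncurry fun x y => (q x y : ℝ≥0∞) * a x y) :=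
    hq.coe_nnreal_ennreal.mul ha
  have hqaG : Measurable fun z : α × α => (q z.1 z.2 : ℝ≥0∞) * a z.1 z.2 * G z := hqa.mul hG
  have hpm : Measurable fun x => (p x : ℝ≥0∞) := hp.coe_nnreal_ennreal
  have hm : Measurable fun x => ∫⁻ y, (q x y : ℝ≥0∞) * a x y * G (x, y) ∂vol :=
    hqaG.lintegral_prod_right'
  have hrej : Measurable fun x => (1 - ∫⁻ z, (q x z : ℝ≥0∞) * a x z ∂vol) * G (x, x) :=
    (measurable_const.sub hqa.lintegral_prod_right').mul
      (hG.comp (measurable_id.prodMk measurable_id))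
  have hflowG : Measurable fun z => flow p q a z * G z := (measurable_flow hp hq ha).mul hG
  rw [Measure.lintegral_compProd hG]
  have hpar (x : α) := lintegral_parKernel (vol := vol) hq ha (F := fun y => G (x, y))
    (hG.comp measurable_prodMk_left) x
  simp only [hpar]
  rw [lintegral_add_left hm, lintegral_withDensity_eq_lintegral_mul _ hpm hm,
    lintegral_withDensity_eq_lintegral_mul _ hpm hrej]
  have hprod : ∫⁻ z, flow p q a z * G z ∂(vol.prod vol) =
      ∫⁻ x, ∫⁻ y, flow p q a (x, y) * G (x, y) ∂vol ∂vol := lintegral_prod _ hflowG.aemeasurable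
  rw [hprod]
  congr 1
  refine lintegral_congr fun x => ?_
  have hqaGx : Measurable fun y => (q x y : ℝ≥0∞) * a x y * G (x, y) :=
    hqaG.comp measurable_prodMk_left
  rw [Pi.mul_apply, ← lintegral_const_mul _ hqaGx]
  simp only [flow, mul_assoc]

/-- The rejection part lives on the diagonal, which the swap fixes; only the accepted moves need
detailed balance. -/
theorem map_swap_compProd_parKernel (hp : Measurable p) (hq : Measurable (Function.uncurry q))
    (hq_one : ∀ x, ∫⁻ y, (q x y : ℝ≥0∞) ∂vol = 1)
    (ha : Measurable (Function.uncurry a)) (ha1 : ∀ x y, a x y ≤ 1)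
    (hbal : ∀ᵐ z ∂(vol.prod vol), flow p q a z.swap = flow p q a z) :
    (vol.withDensity (fun x => (p x : ℝ≥0∞)) ⊗ₘ parKernel vol q a).map Prod.swap =
      vol.withDensity (fun x => (p x : ℝ≥0∞)) ⊗ₘ parKernel vol q a := by
  refine Measure.ext_of_lintegral _ fun G hG => ?_
  rw [lintegral_map hG measurable_swap,
    lintegral_compProd_parKernel hp hq hq_one ha ha1 (G := fun z => G z.swap)
      (hG.comp measurable_swap),
    lintegral_compProd_parKernel hp hq hq_one ha ha1 hG]
  congr 1
  rw [← lintegral_prod_swap]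
  refine lintegral_congr_ae ?_
  filter_upwards [hbal] with z hz
  rw [hz, Prod.swap_swap]

/-- Rejected moves have zero increment. -/
theorem lintegral_sub_sq_compProd_parKernel (hp : Measurable p)
    (hq : Measurable (Function.uncurry q)) (hq_one : ∀ x, ∫⁻ y, (q x y : ℝ≥0∞) ∂vol = 1)
    (ha : Measurable (Function.uncurry a)) (ha1 : ∀ x y, a x y ≤ 1) {f : α → ℝ}
    (hf : Measurable f) :
    ∫⁻ z, ‖f z.1 - f z.2‖ₑ ^ 2 ∂(vol.withDensity (fun x => (p x : ℝ≥0∞)) ⊗ₘ parKernel vol q a) =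
      ∫⁻ z, flow p q a z * ‖f z.1 - f z.2‖ₑ ^ 2 ∂(vol.prod vol) := by
  rw [lintegral_compProd_parKernel hp hq hq_one ha ha1 (by fun_prop)]
  simp

/-- Outside a symmetric set `D` that contains most proposals from every state, the Dirichlet form is
small. -/
theorem lintegral_flow_compl_le (hp : Measurable p) (hq : Measurable (Function.uncurry q))
    (ha : Measurable (Function.uncurry a)) (ha1 : ∀ x y, a x y ≤ 1)
    (hbal : ∀ᵐ z ∂(vol.prod vol), flow p q a z.swap = flow p q a z)
    {D : Set (α × α)} (hD : MeasurableSet D) (hsymm : ∀ z, z.swap ∈ D ↔ z ∈ D) {ε : ℝ≥0∞}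
    (hε : ∀ x, ∫⁻ y in {y | (x, y) ∈ D}ᶜ, (q x y : ℝ≥0∞) ∂vol ≤ ε) {f : α → ℝ}
    (hf : Measurable f) :
    ∫⁻ z in Dᶜ, flow p q a z * ‖f z.1 - f z.2‖ₑ ^ 2 ∂(vol.prod vol) ≤
      4 * ε * ∫⁻ x, ‖f x‖ₑ ^ 2 ∂(vol.withDensity fun x => (p x : ℝ≥0∞)) := by
  have hflow := measurable_flow hp hq ha
  have hm₁ : Measurable fun z : α × α => flow p q a z * ‖f z.1‖ₑ ^ 2 := hflow.mul (by fun_prop)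
  have hm₂ : Measurable fun z : α × α => flow p q a z * ‖f z.2‖ₑ ^ 2 := hflow.mul (by fun_prop)
  have hpf : Measurable fun x => (p x : ℝ≥0∞) * ‖f x‖ₑ ^ 2 :=
    hp.coe_nnreal_ennreal.mul (by fun_prop)
  have hfirst : ∫⁻ z in Dᶜ, flow p q a z * ‖f z.1‖ₑ ^ 2 ∂(vol.prod vol) ≤
      ε * ∫⁻ x, ‖f x‖ₑ ^ 2 ∂(vol.withDensity fun x => (p x : ℝ≥0∞)) := by
    rw [lintegral_withDensity_eq_lintegral_mul _ hp.coe_nnreal_ennreal (by fun_prop),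
      ← lintegral_indicator hD.compl, lintegral_prod _
        (hm₁.indicator hD.compl).aemeasurable]
    simp only [Pi.mul_apply]
    rw [← lintegral_const_mul _ hpf]
    refine lintegral_mono fun x => ?_
    have hDx : MeasurableSet {y | (x, y) ∈ D} := measurable_prodMk_left hD
    have hle (y : α) : Dᶜ.indicator (fun z => flow p q a z * ‖f z.1‖ₑ ^ 2) (x, y) ≤
        (p x * ‖f x‖ₑ ^ 2) * {y | (x, y) ∈ D}ᶜ.indicator (fun y => (q x y : ℝ≥0∞)) y := by
      by_cases hy : (x, y) ∈ D
      · simp [hy]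
      · have h1 : (x, y) ∈ Dᶜ := hy
        have h2 : y ∈ {y | (x, y) ∈ D}ᶜ := hy
        rw [Set.indicator_of_mem h1, Set.indicator_of_mem h2]
        calc flow p q a (x, y) * ‖f x‖ₑ ^ 2 ≤ p x * q x y * 1 * ‖f x‖ₑ ^ 2 := by
              unfold flow
              gcongr
              exact ha1 x y
          _ = _ := by ring
    refine (lintegral_mono hle).trans ?_
    have hqx : Measurable fun y => (q x y : ℝ≥0∞) :=
      hq.coe_nnreal_ennreal.comp measurable_prodMk_left
    rw [lintegral_const_mul _ (hqx.indicator hDx.compl), lintegral_indicator hDx.compl, mul_comm]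
    exact mul_le_mul_left (hε x) _
  -- Detailed balance and the symmetry of `D` exchange the two states.
  have hsecond : ∫⁻ z in Dᶜ, flow p q a z * ‖f z.2‖ₑ ^ 2 ∂(vol.prod vol) =
      ∫⁻ z in Dᶜ, flow p q a z * ‖f z.1‖ₑ ^ 2 ∂(vol.prod vol) := by
    rw [← lintegral_indicator hD.compl, ← lintegral_indicator hD.compl, ← lintegral_prod_swap]
    refine lintegral_congr_ae ?_
    filter_upwards [hbal] with z hz
    by_cases hzD : z ∈ D
    · have h1 : z ∉ Dᶜ := fun h => h hzD
      have h2 : z.swap ∉ Dᶜ := fun h => h ((hsymm z).2 hzD)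
      rw [Set.indicator_of_notMem h1, Set.indicator_of_notMem h2]
    · have h1 : z ∈ Dᶜ := hzD
      have h2 : z.swap ∈ Dᶜ := fun h => hzD ((hsymm z).1 h)
      rw [Set.indicator_of_mem h1, Set.indicator_of_mem h2, hz, Prod.snd_swap]
  -- `(s - t)² ≤ 2s² + 2t²`; the two terms have equal integrals, whence the factor `4`.
  have hsq (z : α × α) : ‖f z.1 - f z.2‖ₑ ^ 2 ≤ 2 * ‖f z.1‖ₑ ^ 2 + 2 * ‖f z.2‖ₑ ^ 2 := by
    have hr (t : ℝ) : ‖t‖ₑ ^ 2 = ENNReal.ofReal (t ^ 2) := by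
      rw [Real.enorm_eq_ofReal_abs, ← ENNReal.ofReal_pow (abs_nonneg _), sq_abs]
    rw [hr, hr, hr]
    rw [← ENNReal.ofReal_ofNat 2, ← ENNReal.ofReal_mul (by norm_num),
      ← ENNReal.ofReal_mul (by norm_num), ← ENNReal.ofReal_add (by positivity) (by positivity)]
    exact ENNReal.ofReal_le_ofReal (by nlinarith [sq_nonneg (f z.1 + f z.2)])
  calc ∫⁻ z in Dᶜ, flow p q a z * ‖f z.1 - f z.2‖ₑ ^ 2 ∂(vol.prod vol)
      ≤ ∫⁻ z in Dᶜ, (2 * (flow p q a z * ‖f z.1‖ₑ ^ 2) + 2 * (flow p q a z * ‖f z.2‖ₑ ^ 2))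
          ∂(vol.prod vol) := by
        refine lintegral_mono fun z => ?_
        calc _ ≤ flow p q a z * (2 * ‖f z.1‖ₑ ^ 2 + 2 * ‖f z.2‖ₑ ^ 2) := by
              gcongr
              exact hsq z
          _ = _ := by ring
    _ = 4 * ∫⁻ z in Dᶜ, flow p q a z * ‖f z.1‖ₑ ^ 2 ∂(vol.prod vol) := by
        rw [lintegral_add_left (hm₁.const_mul _), lintegral_const_mul _ hm₁,
          lintegral_const_mul _ hm₂, hsecond]
        ring
    _ ≤ _ := by
        rw [mul_assoc]
        gcongr

/-- If the accepted moves of one reversible propose-accept-reject kernel are, up to a constant,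
dominated by those of another one except for proposals of uniformly small probability, variance
bounding carries over. -/
theorem varianceBounding_parKernel_of_flow_le (hp : Measurable p)
    (hp_one : ∫⁻ x, (p x : ℝ≥0∞) ∂vol = 1) (hq : Measurable (Function.uncurry q))
    (hq_one : ∀ x, ∫⁻ y, (q x y : ℝ≥0∞) ∂vol = 1)
    (ha : Measurable (Function.uncurry a)) (ha1 : ∀ x y, a x y ≤ 1)
    (ha_bal : ∀ᵐ z ∂(vol.prod vol), flow p q a z.swap = flow p q a z)
    (hb : Measurable (Function.uncurry b)) (hb1 : ∀ x y, b x y ≤ 1)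
    (hb_bal : ∀ᵐ z ∂(vol.prod vol), flow p q b z.swap = flow p q b z)
    (hcomp : ∀ ε : ℝ≥0∞, 0 < ε → ∃ (D : Set (α × α)) (L : ℝ≥0), MeasurableSet D ∧
      (∀ z, z.swap ∈ D ↔ z ∈ D) ∧
      (∀ x, ∫⁻ y in {y | (x, y) ∈ D}ᶜ, (q x y : ℝ≥0∞) ∂vol ≤ ε) ∧ 0 < L ∧
      ∀ᵐ z ∂(vol.prod vol), z ∈ D → flow p q a z ≤ L * flow p q b z)
    (hVB : VarianceBounding (parKernel vol q a) (vol.withDensity fun x => (p x : ℝ≥0∞))) :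
    VarianceBounding (parKernel vol q b) (vol.withDensity fun x => (p x : ℝ≥0∞)) := by
  have : IsProbabilityMeasure (vol.withDensity fun x => (p x : ℝ≥0∞)) :=
    ⟨by rw [withDensity_apply _ MeasurableSet.univ, setLIntegral_univ, hp_one]⟩
  have := isMarkovKernel_parKernel (vol := vol) hq hq_one ha ha1
  have := isMarkovKernel_parKernel (vol := vol) hq hq_one hb hb1
  rw [varianceBounding_iff_poincare
    (map_swap_compProd_parKernel hp hq hq_one ha ha1 ha_bal)] at hVB
  rw [varianceBounding_iff_poincare (map_swap_compProd_parKernel hp hq hq_one hb hb1 hb_bal)]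
  obtain ⟨c, hc, hgap⟩ := hVB
  -- With `ε = c / 8` the far moves cost at most `4ε = c / 2` times `∫ f² dπ`, half of the available
  -- bound.
  obtain ⟨D, L, hD, hsymm, hε, hL, hle⟩ := hcomp ((c / 8 : ℝ≥0) : ℝ≥0∞)
    (by exact_mod_cast (by positivity : 0 < c / 8))
  refine ⟨L⁻¹ * (c / 2), by positivity, fun f hf hf2 hf0 => ?_⟩
  have h := hgap f hf hf2 hf0
  rw [lintegral_sub_sq_compProd_parKernel hp hq hq_one ha ha1 hf] at h
  rw [lintegral_sub_sq_compProd_parKernel hp hq hq_one hb hb1 hf]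
  set V := ∫⁻ x, ‖f x‖ₑ ^ 2 ∂(vol.withDensity fun x => (p x : ℝ≥0∞)) with hV
  have hVfin : V ≠ ∞ := by
    rw [hV, lintegral_enorm_sq_eq_ofReal hf2]
    exact ENNReal.ofReal_ne_top
  set E := ∫⁻ z, flow p q b z * ‖f z.1 - f z.2‖ₑ ^ 2 ∂(vol.prod vol)
  have hnear : ∫⁻ z in D, flow p q a z * ‖f z.1 - f z.2‖ₑ ^ 2 ∂(vol.prod vol) ≤ L * E := by
    have hm : Measurable fun z : α × α => flow p q b z * ‖f z.1 - f z.2‖ₑ ^ 2 :=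
      (measurable_flow hp hq hb).mul (by fun_prop)
    rw [← lintegral_const_mul _ hm]
    refine (lintegral_mono_ae ?_).trans (setLIntegral_le_lintegral D _)
    filter_upwards [ae_restrict_of_ae hle, ae_restrict_mem hD] with z hz hzD
    rw [← mul_assoc]
    exact mul_le_mul_left (hz hzD) _
  have hfar := lintegral_flow_compl_le hp hq ha ha1 ha_bal hD hsymm hε hf
  rw [← lintegral_add_compl _ hD] at h
  have h2 := h.trans (add_le_add hnear hfar)
  have h4 : (4 : ℝ≥0∞) * ((c / 8 : ℝ≥0) : ℝ≥0∞) = ((c / 2 : ℝ≥0) : ℝ≥0∞) := by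
    have : (4 : ℝ≥0) * (c / 8) = c / 2 := by ring
    exact_mod_cast congrArg ((↑) : ℝ≥0 → ℝ≥0∞) this
  have h5 : (c : ℝ≥0∞) * V = ((c / 2 : ℝ≥0) : ℝ≥0∞) * V + ((c / 2 : ℝ≥0) : ℝ≥0∞) * V := by
    rw [← add_mul, ← ENNReal.coe_add, add_halves]
  rw [h4, h5] at h2
  -- The far half is cancelled, which is legitimate because `V` is finite.
  have h6 := (ENNReal.add_le_add_iff_right (ENNReal.mul_ne_top ENNReal.coe_ne_top hVfin)).1 h2
  have hL' : (L : ℝ≥0∞) ≠ 0 := by exact_mod_cast hL.ne'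
  rw [ENNReal.coe_mul, ENNReal.coe_inv hL.ne', mul_assoc]
  calc (L : ℝ≥0∞)⁻¹ * (((c / 2 : ℝ≥0) : ℝ≥0∞) * V) ≤ (L : ℝ≥0∞)⁻¹ * (L * E) := by gcongr
    _ = E := by rw [← mul_assoc, ENNReal.inv_mul_cancel hL' ENNReal.coe_ne_top, one_mul]

end ParKernel

/-! ### Acceptance ratios and pointwise comparison of the flows -/

section AcceptanceRatio

/-- Turns flows into minima that are visibly symmetric. For `A = 0` both sides vanish, whatever the
value of `B / 0`. -/
theorem mul_min_one_div {A : ℝ≥0∞} (hA : A ≠ ∞) (B : ℝ≥0∞) : A * min 1 (B / A) = min A B := by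
  rcases eq_or_ne A 0 with rfl | h0
  · simp
  · rw [mul_min, mul_one, ENNReal.mul_div_cancel h0 hA]

/-- Two-stage acceptance loses at most a factor `L`, if the second ratio is within a factor `L`
of `1` or on the same side of `1` as the first. -/
theorem min_one_mul_le {r s L : ℝ≥0∞} (hL : 1 ≤ L)
    (h : (1 ≤ L * s ∧ s ≤ L) ∨ (r ≤ 1 ∧ s ≤ 1) ∨ (1 ≤ r ∧ 1 ≤ s)) :
    min 1 (r * s) ≤ L * (min 1 r * min 1 s) := by
  rcases le_total s 1 with hs | hs
  · rw [min_eq_right hs]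
    by_cases hr : r ≤ 1
    · rw [min_eq_right hr]
      exact (min_le_right _ _).trans (le_mul_of_one_le_left' hL)
    -- Here `s ≤ 1 < r`: the first stage always accepts, and the second accepts with probability `s
    -- ≥ 1 / L`.
    · have h1 : 1 ≤ L * s := by
        rcases h with h | h | h
        · exact h.1
        · exact absurd h.1 hr
        · exact hL.trans (le_mul_of_one_le_right' h.2)
      rw [min_eq_left (not_le.1 hr).le, one_mul]
      exact (min_le_left _ _).trans h1
  · rw [min_eq_left hs, mul_one]
    by_cases hr : 1 ≤ r
    · rw [min_eq_left hr, mul_one]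
      exact (min_le_left _ _).trans hL
    -- Here `r < 1 ≤ s`: truncating `s` to `1` loses at most the factor `s ≤ L`.
    · have h1 : s ≤ L := by
        rcases h with h | h | h
        · exact h.2
        · exact h.2.trans hL
        · exact absurd h.1 hr
      rw [min_eq_right (not_le.1 hr).le, mul_comm L]
      exact (min_le_right _ _).trans (mul_le_mul_right h1 _)

theorem same_side_of_sign_log_mul_nonneg {r s : ℝ≥0∞}
    (h : 0 ≤ SignType.sign (ENNReal.log r) * SignType.sign (ENNReal.log s)) :
    (r ≤ 1 ∧ s ≤ 1) ∨ (1 ≤ r ∧ 1 ≤ s) := by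
  rcases lt_trichotomy r 1 with hr | rfl | hr
  · rcases le_or_gt s 1 with hs | hs
    · exact Or.inl ⟨hr.le, hs⟩
    · rw [sign_neg (ENNReal.log_lt_zero_iff.2 hr), sign_pos (ENNReal.zero_lt_log_iff.2 hs)] at h
      exact absurd h (by decide)
  · rcases le_total s 1 with hs | hs
    · exact Or.inl ⟨le_rfl, hs⟩
    · exact Or.inr ⟨le_rfl, hs⟩
  · rcases le_or_gt 1 s with hs | hs
    · exact Or.inr ⟨hr.le, hs⟩
    · rw [sign_pos (ENNReal.zero_lt_log_iff.2 hr), sign_neg (ENNReal.log_lt_zero_iff.2 hs)] at h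
      exact absurd h (by decide)

theorem bounds_of_abs_log_le {s : ℝ≥0∞} (hs0 : s ≠ 0) (hs : s ≠ ∞) {M : ℝ≥0}
    (h : (ENNReal.log s).abs ≤ M) :
    1 ≤ ((Real.exp M).toNNReal : ℝ≥0∞) * s ∧ s ≤ ((Real.exp M).toNNReal : ℝ≥0∞) := by
  obtain ⟨t, rfl⟩ : ∃ t, s = ENNReal.ofReal t := ⟨s.toReal, (ENNReal.ofReal_toReal hs).symm⟩
  have ht : 0 < t := by simpa using hs0
  rw [ENNReal.log_ofReal_of_pos ht, EReal.abs_def, ← ENNReal.ofReal_coe_nnreal,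
    ENNReal.ofReal_le_ofReal_iff M.coe_nonneg, abs_le] at h
  change 1 ≤ ENNReal.ofReal (Real.exp M) * _ ∧ _ ≤ ENNReal.ofReal (Real.exp M)
  constructor
  · rw [← ENNReal.ofReal_mul (Real.exp_pos _).le, ENNReal.one_le_ofReal]
    have := (Real.le_log_iff_exp_le ht).1 h.1
    calc (1 : ℝ) = Real.exp M * Real.exp (-M) := by rw [← Real.exp_add]; simp
      _ ≤ _ := by gcongr
  · exact ENNReal.ofReal_le_ofReal ((Real.log_le_iff_le_exp ht).1 h.2)

variable {α : Type*} {p phat : α → ℝ≥0} {q : α → α → ℝ≥0}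

theorem measurable_min_one_rMH [MeasurableSpace α] (hp : Measurable p)
    (hq : Measurable (Function.uncurry q)) :
    Measurable (Function.uncurry fun x y => min 1 (rMH p q x y)) := by
  have h1 : Measurable fun z : α × α => (q z.1 z.2 : ℝ≥0∞) := hq.coe_nnreal_ennreal
  have h2 : Measurable fun z : α × α => (q z.2 z.1 : ℝ≥0∞) := h1.comp measurable_swap
  unfold rMH Function.uncurry
  fun_prop

theorem measurable_min_one_rDA [MeasurableSpace α] (hp : Measurable p)
    (hphat : Measurable phat) (hq : Measurable (Function.uncurry q)) :
    Measurable (Function.uncurry fun x y =>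
      min 1 (rDA₁ phat q x y) * min 1 (rDA₂ p phat x y)) := by
  have h1 : Measurable fun z : α × α => (q z.1 z.2 : ℝ≥0∞) := hq.coe_nnreal_ennreal
  have h2 : Measurable fun z : α × α => (q z.2 z.1 : ℝ≥0∞) := h1.comp measurable_swap
  unfold rDA₁ rDA₂ Function.uncurry
  fun_prop

theorem flow_mh (z : α × α) : flow p q (fun x y => min 1 (rMH p q x y)) z =
    min ((p z.1 : ℝ≥0∞) * q z.1 z.2) ((p z.2 : ℝ≥0∞) * q z.2 z.1) :=
  mul_min_one_div (ENNReal.mul_ne_top ENNReal.coe_ne_top ENNReal.coe_ne_top) _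

theorem coe_div_ne_top {x : α} (h : phat x = 0 → p x = 0) : (p x : ℝ≥0∞) / phat x ≠ ∞ := by
  by_cases hx : phat x = 0
  · simp [h hx, hx]
  · exact ENNReal.div_ne_top ENNReal.coe_ne_top (by exact_mod_cast hx)

theorem coe_mul_div_cancel {x : α} (h : phat x = 0 → p x = 0) :
    (phat x : ℝ≥0∞) * ((p x : ℝ≥0∞) / phat x) = p x := by
  by_cases hx : phat x = 0
  · simp [h hx, hx]
  · exact ENNReal.mul_div_cancel (by exact_mod_cast hx) ENNReal.coe_ne_top

/-- Splitting `p = phat · (p / phat)` gives each stage its own weight, and each becomes a minimum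
symmetric in the two states. This is the source of detailed balance for DA. -/
theorem flow_da {z : α × α} (h : phat z.1 = 0 → p z.1 = 0) :
    flow p q (fun x y => min 1 (rDA₁ phat q x y) * min 1 (rDA₂ p phat x y)) z =
      min ((phat z.1 : ℝ≥0∞) * q z.1 z.2) ((phat z.2 : ℝ≥0∞) * q z.2 z.1) *
        min ((p z.1 : ℝ≥0∞) / phat z.1) ((p z.2 : ℝ≥0∞) / phat z.2) := by
  rw [← mul_min_one_div (ENNReal.mul_ne_top ENNReal.coe_ne_top ENNReal.coe_ne_top),
    ← mul_min_one_div (coe_div_ne_top h), flow]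
  conv_lhs => rw [← coe_mul_div_cancel h]
  simp only [rDA₁, rDA₂]
  ring

/-- The factors `phat` cancel once the denominators are nonzero; `q y x` and `p y` may vanish. -/
theorem rMH_eq_mul {x y : α} (hx : phat x ≠ 0) (hy : phat y ≠ 0) (hpx : p x ≠ 0)
    (hqxy : q x y ≠ 0) : rMH p q x y = rDA₁ phat q x y * rDA₂ p phat x y := by
  have h : p y * q y x / (p x * q x y) =
      phat y * q y x / (phat x * q x y) * (p y / phat y / (p x / phat x)) := by
    field_simp
  have h2 := congrArg ((↑) : ℝ≥0 → ℝ≥0∞) h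
  rw [ENNReal.coe_mul, ENNReal.coe_div (mul_ne_zero hpx hqxy),
    ENNReal.coe_div (mul_ne_zero hx hqxy), ENNReal.coe_div (div_ne_zero hpx hx),
    ENNReal.coe_div hx, ENNReal.coe_div hy] at h2
  simpa [rMH, rDA₁, rDA₂] using h2

/-- Where the log-error discrepancy is at most `M`, or the two ratios are on the same side of `1`,
delayed acceptance loses at most a factor `exp M`. -/
theorem flow_mh_le_flow_da {x y : α} (hx : phat x = 0 → p x = 0) (hy : phat y = 0 → p y = 0)
    {M : ℝ≥0} (h : p x ≠ 0 → q x y ≠ 0 →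
      logErrorDiscrepancy p phat x y ≤ M ∨ y ∈ noProblemSet p phat q x) :
    flow p q (fun x y => min 1 (rMH p q x y)) (x, y) ≤ ((Real.exp M).toNNReal : ℝ≥0∞) *
      flow p q (fun x y => min 1 (rDA₁ phat q x y) * min 1 (rDA₂ p phat x y)) (x, y) := by
  by_cases hpx : p x = 0
  · simp [flow_mh, hpx]
  by_cases hqxy : q x y = 0
  · simp [flow_mh, hqxy]
  -- If `p y = 0` the MH flow vanishes; otherwise `r_2` is neither `0` nor `∞` and its logarithm is
  -- real.
  by_cases hpy : p y = 0
  · simp [flow_mh, hpy]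
  have hx' : phat x ≠ 0 := fun h0 => hpx (hx h0)
  have hy' : phat y ≠ 0 := fun h0 => hpy (hy h0)
  have hL : (1 : ℝ≥0∞) ≤ ((Real.exp M).toNNReal : ℝ≥0∞) := by
    change 1 ≤ ENNReal.ofReal (Real.exp M)
    exact ENNReal.one_le_ofReal.2 (Real.one_le_exp M.2)
  have hs : rDA₂ p phat x y = ((p y / phat y / (p x / phat x) : ℝ≥0) : ℝ≥0∞) := by
    rw [rDA₂, ENNReal.coe_div (div_ne_zero hpx hx'), ENNReal.coe_div hx', ENNReal.coe_div hy']
  have hs0 : rDA₂ p phat x y ≠ 0 := by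
    rw [hs]
    exact_mod_cast div_ne_zero (div_ne_zero hpy hy') (div_ne_zero hpx hx')
  have key := min_one_mul_le (r := rDA₁ phat q x y) (s := rDA₂ p phat x y) hL (by
    rcases h hpx hqxy with h | h
    · exact Or.inl (bounds_of_abs_log_le hs0 (hs ▸ ENNReal.coe_ne_top) h)
    · exact Or.inr (same_side_of_sign_log_mul_nonneg h))
  simp only [flow, rMH_eq_mul hx' hy' hpx hqxy]
  rw [mul_left_comm]
  gcongr

end AcceptanceRatio

/-! ### Measurability and symmetry of the distance -/

section StateSpace

variable {d : ℕ} {X : Set (EuclideanSpace ℝ (Fin d))}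

theorem StateSpace.measurable_pt : Measurable (StateSpace.pt (X := X)) := fun s hs =>
  ⟨s, hs.nullMeasurableSet, rfl⟩

theorem measurable_stateDist (N : Seminorm ℝ (EuclideanSpace ℝ (Fin d))) :
    Measurable fun z : StateSpace X × StateSpace X => stateDist N z.1 z.2 := by
  -- A convex function on a finite-dimensional space is continuous.
  have hN : Continuous N := continuousOn_univ.1 (N.convexOn.continuousOn isOpen_univ)
  have h : Measurable fun z : StateSpace X × StateSpace X => N (z.2.pt - z.1.pt) :=
    hN.measurable.comp ((StateSpace.measurable_pt.comp measurable_snd).sub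
      (StateSpace.measurable_pt.comp measurable_fst))
  exact h.subtype_mk

theorem stateDist_comm (N : Seminorm ℝ (EuclideanSpace ℝ (Fin d))) (x y : StateSpace X) :
    stateDist N x y = stateDist N y x :=
  NNReal.eq (map_sub_rev N _ _)

end StateSpace

end DelayedAcceptance

theorem corollary3 {d : ℕ}
    -- a norm on `ℝ^d`
    (N : Seminorm ℝ (EuclideanSpace ℝ (Fin d))) (hN : ∀ v, N v = 0 → v = 0)
    -- a Lebesgue-measurable state space
    (X : Set (EuclideanSpace ℝ (Fin d))) (hX : NullMeasurableSet X volume)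
    -- the target density
    (p : DelayedAcceptance.StateSpace X → ℝ≥0) (hp : Measurable p)
    (hp_one : ∫⁻ x, (p x : ℝ≥0∞) ∂(DelayedAcceptance.lebesgue X) = 1)
    -- the approximation, positive wherever (up to null sets) the target is
    (phat : DelayedAcceptance.StateSpace X → ℝ≥0) (hphat : Measurable phat)
    (hphat_pos : ∀ᵐ x ∂((DelayedAcceptance.lebesgue X).withDensity (fun x => (p x : ℝ≥0∞))),
      0 < phat x)
    -- the proposal density
    (q : DelayedAcceptance.StateSpace X → DelayedAcceptance.StateSpace X → ℝ≥0)
    (hq : Measurable (Function.uncurry q))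
    (hq_one : ∀ x, ∫⁻ y, (q x y : ℝ≥0∞) ∂(DelayedAcceptance.lebesgue X) = 1)
    (hq_local : DelayedAcceptance.IsLocal N q)
    -- the growth condition on the log-error discrepancy, for the states that can be proposed
    (h : ℝ≥0 → ℝ≥0) (hh : ∀ r, BddAbove (h '' Set.Icc 0 r))
    (hdiscrep : ∀ᵐ x ∂((DelayedAcceptance.lebesgue X).withDensity (fun x => (p x : ℝ≥0∞))),
      {y | 0 < q x y ∧ (h (DelayedAcceptance.stateDist N x y) : ℝ≥0∞) <
          DelayedAcceptance.logErrorDiscrepancy p phat x y} ⊆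
        DelayedAcceptance.noProblemSet p phat q x)
    (hMH : DelayedAcceptance.VarianceBounding
      (DelayedAcceptance.mhKernel (DelayedAcceptance.lebesgue X) p q)
      ((DelayedAcceptance.lebesgue X).withDensity (fun x => (p x : ℝ≥0∞)))) :
    DelayedAcceptance.VarianceBounding
      (DelayedAcceptance.daKernel (DelayedAcceptance.lebesgue X) p phat q)
      ((DelayedAcceptance.lebesgue X).withDensity (fun x => (p x : ℝ≥0∞))) := by
  -- A `π`-null set is Lebesgue-null only where `p` is nonzero, so the positivity of `phat` becomes
  -- an implication.
  have hgood : ∀ᵐ x ∂(DelayedAcceptance.lebesgue X), phat x = 0 → p x = 0 := by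
    rw [ae_withDensity_iff hp.coe_nnreal_ennreal] at hphat_pos
    filter_upwards [hphat_pos] with x hx h0
    by_contra hpx
    exact (hx (by exact_mod_cast hpx)).ne' h0
  have hdisc := (ae_withDensity_iff hp.coe_nnreal_ennreal).1 hdiscrep
  have hgood₁ : ∀ᵐ z ∂((DelayedAcceptance.lebesgue X).prod (DelayedAcceptance.lebesgue X)),
      phat z.1 = 0 → p z.1 = 0 := Measure.quasiMeasurePreserving_fst.ae hgood
  have hgood₂ : ∀ᵐ z ∂((DelayedAcceptance.lebesgue X).prod (DelayedAcceptance.lebesgue X)),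
      phat z.2 = 0 → p z.2 = 0 := Measure.quasiMeasurePreserving_snd.ae hgood
  have hdisc₁ := (Measure.quasiMeasurePreserving_fst (μ := DelayedAcceptance.lebesgue X)
    (ν := DelayedAcceptance.lebesgue X)).ae hdisc
  refine DelayedAcceptance.varianceBounding_parKernel_of_flow_le hp hp_one hq hq_one
    (DelayedAcceptance.measurable_min_one_rMH hp hq) (fun x y => min_le_left _ _)
    (ae_of_all _ fun z => ?_)
    (DelayedAcceptance.measurable_min_one_rDA hp hphat hq)
    (fun x y => mul_le_one' (min_le_left _ _) (min_le_left _ _)) ?_ (fun ε hε => ?_) hMH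
  · rw [DelayedAcceptance.flow_mh, DelayedAcceptance.flow_mh, min_comm]
    rfl
  -- Detailed balance for DA needs the implication at both states, hence holds for almost all pairs
  -- only.
  · filter_upwards [hgood₁, hgood₂] with z h1 h2
    rw [DelayedAcceptance.flow_da h1, DelayedAcceptance.flow_da (z := z.swap) h2, min_comm,
      min_comm ((p z.swap.1 : ℝ≥0∞) / _)]
    rfl
  -- `D` is the set of pairs at distance less than `r`, and `L = exp M` with `M` a bound for `h` on
  -- `[0, r]`.
  · obtain ⟨r, hr⟩ := hq_local ε hε
    obtain ⟨M, hM⟩ := hh r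
    have hDm : MeasurableSet {z : DelayedAcceptance.StateSpace X × DelayedAcceptance.StateSpace X |
        DelayedAcceptance.stateDist N z.1 z.2 < r} :=
      measurableSet_lt (DelayedAcceptance.measurable_stateDist N) measurable_const
    refine ⟨_, (Real.exp M).toNNReal, hDm, fun z => ?_, fun x => (hr x).le,
      Real.toNNReal_pos.2 (Real.exp_pos _), ?_⟩
    · simp only [Set.mem_ofPred_eq, Prod.fst_swap, Prod.snd_swap,
        DelayedAcceptance.stateDist_comm N z.2 z.1]
    · filter_upwards [hgood₁, hgood₂, hdisc₁] with z h1 h2 h3 hz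
      refine DelayedAcceptance.flow_mh_le_flow_da h1 h2 fun hpx hqxy => ?_
      by_cases hlt : (h (DelayedAcceptance.stateDist N z.1 z.2) : ℝ≥0∞) <
          DelayedAcceptance.logErrorDiscrepancy p phat z.1 z.2
      · exact Or.inr (h3 (by exact_mod_cast hpx) ⟨pos_of_ne_zero hqxy, hlt⟩)
      · refine Or.inl ((not_lt.1 hlt).trans ?_)
        exact_mod_cast hM ⟨_, ⟨zero_le, le_of_lt hz⟩, rfl⟩
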